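/- **Definitions.** A (one-dimensional) cellular automaton (CA) with finite state set $A$ is identified with its global map $F:A^{\mathbb Z}\to A^{\mathbb Z}$, given by a finite neighbourhood and one local rule. Let $\sigma_z(c)_x=c_{x-z}$ be the shift and, for $m\ge 1$, let $b_m:A^{\mathbb Z}\to (A^m)^{\mathbb Z}$, $b_m(c)_z=(c_{mz},\dots,c_{mz+m-1})$, be the packing bijection. For $m,t\ge 1$ and $z\in\mathbb Z$ the rescaling of $F$ is $F^{\langle m,t,z\rangle}=b_m\circ\sigma_z\circ F^t\circ b_m^{-1}$. A CA $G$ over $A$ is a sub-automaton of a CA $H$ over $B$ if there is an injection $\varphi:A\to B$ whose cellwise extension $\overline\varphi$ satisfies $\overline\varphi\circ G=H\circ\overline\varphi$. A CA $F$ simulates a CA $G$ if there are $m_1,t_1,m_2,t_2\ge 1$ and $z_1,z_2\in\mathbb Z$ such that $G^{\langle m_1,t_1,z_1\rangle}$ is a sub-automaton of $F^{\langle m_2,t_2,z_2\rangle}$. The dual of a reversible CA $F$ is $\tilde F=\mathrm{mirror}\circ F^{-1}\circ \mathrm{mirror}$, where $\mathrm{mirror}(c)_z=c_{-z}$. For a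 configuration $c$, let $F^y_{x,c}:A\to A$ send $q$ to the state of cell $x$ in $F^y(c')$, where $c'$ is $c$ with the state of cell $0$ replaced by $q$. Say that $F$ has property $(x,y,l,r)$, for $x\in\mathbb Z$ and $y,l,r\in\mathbb N$, if for every $c$ the map $F^y_{x,c}$ is bijective and $F^y_{z,c}$ is constant for every integer $z\in[x-l,x+r]$, $z\neq x$. For $p\ge 2$ let $X_p(F)$ be the set of $(x,y)\in\mathbb R\times[0,\infty)$ such that, for some $k\in\mathbb N$ and all large enough $n$, the numbers $xp^n,yp^n$ are integers and $F$ has property $(xp^n,yp^n,p^{n-k},p^{n-k})$. Put $\pi_{\alpha,\beta,\gamma}(x,y)=(\alpha x+\beta y,\gamma y)$. **Proposition.** Let $\Gamma$ be the linear CA with state set $(\mathbb Z/2)^3$ and matrix $$\Gamma=\begin{pmatrix}0&0&1\\0&1&u\\1&u&0\end{pmatrix},$$ where $u$ acts as the shift $\sigma_1$. It is reversible, and $\Gamma^{-1}$ is the linear CA with matrix $\begin{pmatrix}u^2&u&1\\u&1&0\\1&0&0\end{pmatrix}$. Then: 1. $\Gamma$ simulates neither its inverse $\Gamma^{-1}$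 nor its dual $\tilde\Gamma$. 2. $\overline{X_2(\Gamma)}$ contains the half-lines $\mathbb R_+(0,1)$ and $\mathbb R_+(1,1)$ and the segment $[(0,1),(\tfrac23,\tfrac23)]$. 3. No point of $X_2(\Gamma^{-1})$ lies in the interior of the triangle with vertices $(0,1)$, $(\tfrac23,\tfrac13)$, $(\tfrac23,\tfrac43)$. 4. For all real $\alpha,\gamma>0$ and $\beta$, neither $\pi_{\alpha,\beta,\gamma}(\overline{X_2(\Gamma)})\subseteq\overline{X_2(\Gamma^{-1})}$ nor $\pi_{\alpha,\beta,\gamma}(\overline{X_2(\Gamma)})\subseteq\overline{X_2(\tilde\Gamma)}$ holds. -/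

import Mathlib

open Filter
open scoped LaurentPolynomial

noncomputable section

/-- A one-dimensional cellular automaton with finite state set `A`: a global map on configurations
`ℤ → A` given by one local rule `f` applied to a finite neighbourhood `N` of every cell. -/
structure CellularAutomaton (A : Type*) [Finite A] where
  /-- The global map. -/
  toFun : (ℤ → A) → (ℤ → A)
  isLocal : ∃ (N : Finset ℤ) (f : (N → A) → A), ∀ (c : ℤ → A) (x : ℤ),
    toFun c x = f (fun i => c (x + i))

namespace CellularAutomaton

variable {A B : Type*} [Finite A] [Finite B]

instance : CoeFun (CellularAutomaton A) (fun _ => (ℤ → A) → (ℤ → A)) := ⟨toFun⟩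

/-- The identity. -/
protected def id : CellularAutomaton A where
  toFun c := c
  isLocal := ⟨{0}, fun w => w ⟨0, by simp⟩, fun c x => by simp⟩

/-- Composition `F ∘ G`. -/
def comp (F G : CellularAutomaton A) : CellularAutomaton A where
  toFun c := F (G c)
  isLocal := by
    obtain ⟨N, f, hf⟩ := F.isLocal
    obtain ⟨M, g, hg⟩ := G.isLocal
    refine ⟨Finset.image₂ (· + ·) N M,
      fun w => f fun i => g fun j => w ⟨i + j, Finset.mem_image₂_of_mem i.2 j.2⟩, ?_⟩
    intro c x
    simp only [hf, hg, add_assoc]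

/-- The iterate `F ^ t`. -/
def iter (F : CellularAutomaton A) : ℕ → CellularAutomaton A
  | 0 => CellularAutomaton.id
  | t + 1 => (F.iter t).comp F

theorem iter_apply (F : CellularAutomaton A) (t : ℕ) (c : ℤ → A) :
    F.iter t c = F.toFun^[t] c := by
  induction t generalizing c with
  | zero => rfl
  | succ t ih => rw [Function.iterate_succ_apply, ← ih]; rfl

/-- The shift `σ_z`, with `σ_z(c)_x = c_{x-z}`. -/
def shift (z : ℤ) : CellularAutomaton A where
  toFun c x := c (x - z)
  isLocal := ⟨{-z}, fun w => w ⟨-z, by simp⟩, fun c x => by simp [sub_eq_add_neg]⟩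

/-- The bijective packing map `b_m`, grouping cells into blocks of length `m`. -/
def pack (A : Type*) (m : ℕ+) : (ℤ → A) ≃ (ℤ → (Fin m → A)) where
  toFun c z j := c (m * z + (j : ℕ))
  invFun d x := d (x / (m : ℕ)) ⟨(x % (m : ℕ)).toNat, by
    have h := m.pos
    have h1 := Int.emod_lt_of_pos x (b := ((m : ℕ) : ℤ)) (by exact_mod_cast h)
    have h2 := Int.emod_nonneg x (b := ((m : ℕ) : ℤ)) (by positivity)
    omega⟩
  left_inv c := by
    funext x
    have h2 := Int.emod_nonneg x (b := ((m : ℕ) : ℤ)) (by have := m.pos; positivity)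
    simp only [Int.toNat_of_nonneg h2]
    congr 1
    exact Int.mul_ediv_add_emod x _
  right_inv d := by
    funext z j
    have h : (0 : ℤ) < (m : ℕ) := by exact_mod_cast m.pos
    have hj : ((j : ℕ) : ℤ) < (m : ℕ) := by exact_mod_cast j.2
    have h1 : (((m : ℕ) : ℤ) * z + (j : ℕ)) / (m : ℕ) = z := by
      rw [add_comm, Int.add_mul_ediv_left _ _ h.ne', Int.ediv_eq_zero_of_lt (by positivity) hj,
        zero_add]
    have h2 : (((m : ℕ) : ℤ) * z + (j : ℕ)) % (m : ℕ) = (j : ℕ) := by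
      rw [add_comm, Int.add_mul_emod_self_left, Int.emod_eq_of_lt (by positivity) hj]
    simp only [h1, h2, Int.toNat_natCast, Fin.eta]

/-- The packed automaton `b_m ∘ F ∘ b_m⁻¹`, with state set `A ^ m`. -/
def group (F : CellularAutomaton A) (m : ℕ+) : CellularAutomaton (Fin m → A) where
  toFun d := pack A m (F ((pack A m).symm d))
  isLocal := by
    obtain ⟨N, f, hf⟩ := F.isLocal
    have hm : (0 : ℤ) < (m : ℕ) := by exact_mod_cast m.pos
    refine ⟨Finset.image₂ (fun (j : Fin m) n => (((j : ℕ) : ℤ) + n) / (m : ℕ)) Finset.univ N,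
      fun w j => f fun n => w ⟨(((j : ℕ) : ℤ) + n) / (m : ℕ),
        Finset.mem_image₂_of_mem (Finset.mem_univ j) n.2⟩
          ⟨((((j : ℕ) : ℤ) + n) % (m : ℕ)).toNat, by
            have h1 := Int.emod_lt_of_pos (((j : ℕ) : ℤ) + n) hm
            have h2 := Int.emod_nonneg (((j : ℕ) : ℤ) + n) hm.ne'
            omega⟩, ?_⟩
    intro d x
    funext j
    simp only [pack, Equiv.coe_fn_mk, Equiv.coe_fn_symm_mk, hf]
    congr 1
    funext n
    have e : ((m : ℕ) : ℤ) * x + (j : ℕ) + n = ((j : ℕ) + n) + (m : ℕ) * x := by ring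
    have h1 : (((m : ℕ) : ℤ) * x + (j : ℕ) + n) / (m : ℕ) = x + (((j : ℕ) : ℤ) + n) / (m : ℕ) := by
      rw [e, Int.add_mul_ediv_left _ _ hm.ne', add_comm]
    have h2 : (((m : ℕ) : ℤ) * x + (j : ℕ) + n) % (m : ℕ) = (((j : ℕ) : ℤ) + n) % (m : ℕ) := by
      rw [e, Int.add_mul_emod_self_left]
    simp only [h1, h2]

/-- The rescaling `b_m ∘ σ_z ∘ F ^ t ∘ b_m⁻¹`. -/
def rescale (F : CellularAutomaton A) (m t : ℕ+) (z : ℤ) : CellularAutomaton (Fin m → A) :=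
  ((shift z).comp (F.iter t)).group m

/-- `F` is a sub-automaton of `G`: some injection `φ` of the state sets, applied cell by cell,
intertwines the two global maps. -/
def IsSubautomaton (F : CellularAutomaton A) (G : CellularAutomaton B) : Prop :=
  ∃ φ : A → B, Function.Injective φ ∧ ∀ c : ℤ → A, φ ∘ F c = G (φ ∘ c)

/-- `F` simulates `G`: some rescaling of `G` is a sub-automaton of some rescaling of `F`. -/
def Simulates (F : CellularAutomaton A) (G : CellularAutomaton B) : Prop :=
  ∃ (m₁ t₁ m₂ t₂ : ℕ+) (z₁ z₂ : ℤ),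
    (G.rescale m₁ t₁ z₁).IsSubautomaton (F.rescale m₂ t₂ z₂)

/-- The mirror image `mirror ∘ F ∘ mirror`, where `mirror(c)_z = c_{-z}`. -/
def mirror (F : CellularAutomaton A) : CellularAutomaton A where
  toFun c z := F (fun y => c (-y)) (-z)
  isLocal := by
    obtain ⟨N, f, hf⟩ := F.isLocal
    refine ⟨N.image (fun n => -n),
      fun w => f fun n => w ⟨-n, Finset.mem_image_of_mem _ n.2⟩, ?_⟩
    intro c x
    simp only [hf, neg_add_rev, neg_neg]
    congr 1
    funext n
    congr 1
    ring

/-- The map `q ↦ F ^ y (c with the state of cell 0 replaced by q)_x`. -/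
def green (F : CellularAutomaton A) (x : ℤ) (y : ℕ) (c : ℤ → A) (q : A) : A :=
  F.iter y (Function.update c 0 q) x

/-- The state of cell `0` at time `0` always determines bijectively the state of cell `x` at time
`y`, and never influences another cell of `[x - l, x + r]` at time `y`. -/
def Concentrated (F : CellularAutomaton A) (x : ℤ) (y l r : ℕ) : Prop :=
  (∀ c, Function.Bijective (F.green x y c)) ∧
    ∀ c, ∀ z ∈ Set.Icc (x - l) (x + r), z ≠ x → ∀ q q' : A, F.green z y c q = F.green z y c q'

/-- The set `X_p(F)` of the points `(x, y)`, `y ≥ 0`, such that for some `k` and all large enough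
`n`, the numbers `x p ^ n` and `y p ^ n` are integers and `F` is concentrated with parameters
`(x p ^ n, y p ^ n, p ^ (n - k), p ^ (n - k))`. -/
def fingerprint (F : CellularAutomaton A) (p : ℕ) : Set (ℝ × ℝ) :=
  {P | 0 ≤ P.2 ∧ ∃ k : ℕ, ∀ᶠ n : ℕ in atTop, k ≤ n ∧ ∃ (a : ℤ) (b : ℕ),
    (a : ℝ) = P.1 * (p : ℝ) ^ n ∧ (b : ℝ) = P.2 * (p : ℝ) ^ n ∧
      F.Concentrated a b (p ^ (n - k)) (p ^ (n - k))}

/-- The linear cellular automaton over `R ^ d` with a given matrix of Laurent polynomials; the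
indeterminate `u` acts as the shift `σ_1`, that is, `(u c)_x = c_{x-1}`. -/
def linear {R : Type*} [CommRing R] [Finite R] {d : ℕ} (M : Matrix (Fin d) (Fin d) R[T;T⁻¹]) :
    CellularAutomaton (Fin d → R) where
  toFun c x i := ∑ j, (M i j).coeff.sum fun k a => a * c (x - k) j
  isLocal := by
    classical
    let N : Finset ℤ := Finset.univ.biUnion fun i => Finset.univ.biUnion fun j =>
      (M i j).coeff.support.image fun k => -k
    refine ⟨N, fun w i => ∑ j, ∑ k ∈ (M i j).coeff.support,
      (M i j).coeff k * (if h : -k ∈ N then w ⟨-k, h⟩ j else 0), ?_⟩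
    intro c x
    funext i
    refine Finset.sum_congr rfl fun j _ => Finset.sum_congr rfl fun k hk => ?_
    have h : -k ∈ N := by
      simp only [N, Finset.mem_biUnion, Finset.mem_univ, true_and]
      exact ⟨i, j, Finset.mem_image_of_mem _ hk⟩
    simp only [dif_pos h, sub_eq_add_neg]

end CellularAutomaton

/-- A reversible cellular automaton, together with its inverse. -/
structure ReversibleCA (A : Type*) [Finite A] where
  /-- The automaton itself. -/
  ca : CellularAutomaton A
  /-- Its inverse. -/
  inv : CellularAutomaton A
  inv_ca : ∀ c, inv (ca c) = c
  ca_inv : ∀ c, ca (inv c) = c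

/-- The dual `mirror ∘ F⁻¹ ∘ mirror`. -/
def ReversibleCA.dual {A : Type*} [Finite A] (F : ReversibleCA A) : CellularAutomaton A :=
  F.inv.mirror

theorem laurent_sum_T {M : Type*} [AddCommMonoid M] (n : ℤ) (f : ℤ → ZMod 2 → M)
    (h : f n 0 = 0) : (LaurentPolynomial.T n : (ZMod 2)[T;T⁻¹]).coeff.sum f = f n 1 :=
  Finsupp.sum_single_index h

open LaurentPolynomial CellularAutomaton in
/-- The reversible linear cellular automaton `Γ` over `(ℤ/2) ^ 3`. -/
def gammaCA : ReversibleCA (Fin 3 → ZMod 2) where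
  ca := linear !![0, 0, 1; 0, 1, T 1; 1, T 1, 0]
  inv := linear !![T 2, T 1, 1; T 1, 1, 0; 1, 0, 0]
  inv_ca c := by
    funext x i
    have h1 : (1 : (ZMod 2)[T;T⁻¹]) = T 0 := T_zero.symm
    have e (a : ZMod 2) : a + a = 0 := CharTwo.add_self_eq_zero a
    fin_cases i <;>
      simp [linear, Fin.sum_univ_three, h1, laurent_sum_T, sub_sub, -T_zero]
    · linear_combination e (c (x - 2) 2) + e (c (x - 1) 1)
    · linear_combination e (c (x - 1) 2)
  ca_inv c := by
    funext x i
    have h1 : (1 : (ZMod 2)[T;T⁻¹]) = T 0 := T_zero.symm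
    have e (a : ZMod 2) : a + a = 0 := CharTwo.add_self_eq_zero a
    fin_cases i <;>
      simp [linear, Fin.sum_univ_three, h1, laurent_sum_T, sub_sub, -T_zero]
    · linear_combination e (c (x - 1) 0)
    · linear_combination e (c (x - 2) 0) + e (c (x - 1) 1)

/-- The plane map `π_{α,β,γ}(x, y) = (α x + β y, γ y)`. -/
def planeMap (α β γ : ℝ) (P : ℝ × ℝ) : ℝ × ℝ := (α * P.1 + β * P.2, γ * P.2)

end

/-! Write `u` for `T 1`, G for the matrix of Γ and D for its inverse. In characteristic two, the
2^n-th power distributes over sums of commuting matrices. With X = D² + 1, the identity X³ = u⁴(X² +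
1) (`dMat_sq_add_one_cube`) therefore yields D^(2^n) = 1 + O(u^c) with c about (2/3)2^n, and the
same for G.

Two consequences follow. Multiplying by D^t or G^t, whose degrees are at most 2t and t, leaves a gap
in the exponents of D^(2^n ± t); at large scale these gaps form a triangle in space-time where the
inverse has no influence (`coeff_dMat_pow_eq_zero`). On the other hand, some powers of G coincide
with a pure shift u^x on a long window around x. These points accumulate on the half-lines x = 0 and
x = y, and on the segment y = 1 - x/2, where D^b seen along the edge of its cone reappears in G^(2^n
- b) (`gMat_agreesNear_segment`).

A simulation transports space-time by a map π with α, γ > 0. Every half-line strictly inside the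
light cone of Γ⁻¹ meets a vacuum triangle, so π must send the two half-lines to the two edges of the
cone. This determines π up to scale, and the image of the segment then enters a vacuum triangle. The
mirrored argument treats the dual. A point where Γ acts as a shift while the other automaton has no
influence contradicts injectivity of the embedding of state sets
(`HasKernel.not_isSubautomaton_rescale`); at the level of fingerprints it contradicts bijectivity of
the Green map. -/

noncomputable section

open LaurentPolynomial

/-! ### Supports of Laurent polynomial matrices -/

/-- All exponents occurring in the entries of the Laurent polynomial matrix `A` lie in `s`. -/
def SuppIn {R : Type*} [CommRing R] {d : ℕ} (s : Set ℤ) (A : Matrix (Fin d) (Fin d) R[T;T⁻¹]) :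
    Prop :=
  ∀ i j k, (A i j).coeff k ≠ 0 → k ∈ s

namespace SuppIn

variable {R : Type*} [CommRing R] {d : ℕ} {s t r : Set ℤ} {A B : Matrix (Fin d) (Fin d) R[T;T⁻¹]}

theorem mono (h : SuppIn s A) (hst : s ⊆ t) : SuppIn t A := fun i j k hk => hst (h i j k hk)

theorem coeff_eq_zero (h : SuppIn s A) {k : ℤ} (hk : k ∉ s) (i j : Fin d) :
    (A i j).coeff k = 0 := by
  by_contra h0
  exact hk (h i j k h0)

theorem add (hA : SuppIn s A) (hB : SuppIn s B) : SuppIn s (A + B) := by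
  intro i j k hk
  by_contra h
  refine hk ?_
  rw [Matrix.add_apply, AddMonoidAlgebra.coeff_add, Finsupp.add_apply, hA.coeff_eq_zero h,
    hB.coeff_eq_zero h, add_zero]

theorem mul (hA : SuppIn s A) (hB : SuppIn t B) (h : ∀ a ∈ s, ∀ b ∈ t, a + b ∈ r) :
    SuppIn r (A * B) := by
  classical
  intro i j k hk
  rw [Matrix.mul_apply, AddMonoidAlgebra.coeff_sum, Finsupp.finsetSum_apply] at hk
  obtain ⟨l, -, hl⟩ := Finset.exists_ne_zero_of_sum_ne_zero hk
  have h1 := AddMonoidAlgebra.support_coeff_mul_subset (A i l) (B l j)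
    (Finsupp.mem_support_iff.2 hl)
  obtain ⟨a, ha, b, hb, rfl⟩ := Finset.mem_add.1 h1
  exact h a (hA _ _ _ (Finsupp.mem_support_iff.1 ha)) b (hB _ _ _ (Finsupp.mem_support_iff.1 hb))

theorem one (h : (0 : ℤ) ∈ s) : SuppIn s (1 : Matrix (Fin d) (Fin d) R[T;T⁻¹]) := by
  intro i j k hk
  by_cases hij : i = j
  · subst hij
    rw [Matrix.one_apply_eq, ← T_zero, T_apply] at hk
    have : (0 : ℤ) = k := by by_contra h0; simp [h0] at hk
    rwa [← this]
  · simp [Matrix.one_apply_ne hij] at hk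

theorem T_smul (x : ℤ) (hA : SuppIn s A) (h : ∀ a ∈ s, x + a ∈ r) :
    SuppIn r ((T x : R[T;T⁻¹]) • A) := by
  classical
  intro i j k hk
  rw [Matrix.smul_apply, smul_eq_mul] at hk
  have h1 := AddMonoidAlgebra.support_coeff_mul_subset _ _ (Finsupp.mem_support_iff.2 hk)
  obtain ⟨a, ha, b, hb, rfl⟩ := Finset.mem_add.1 h1
  have : x = a := by
    by_contra h0
    simp [h0] at ha
  exact this ▸ h b (hA _ _ _ (Finsupp.mem_support_iff.1 hb))

theorem pow_Iic {e : ℤ} (hA : SuppIn (Set.Iic e) A) (n : ℕ) :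
    SuppIn (Set.Iic (n * e)) (A ^ n) := by
  induction n with
  | zero => exact pow_zero A ▸ one (by simp)
  | succ n ih =>
    rw [pow_succ]
    refine ih.mul hA fun a ha b hb => ?_
    simp only [Set.mem_Iic] at *
    push_cast
    linarith

theorem pow_Ici {e : ℤ} (hA : SuppIn (Set.Ici e) A) (n : ℕ) :
    SuppIn (Set.Ici (n * e)) (A ^ n) := by
  induction n with
  | zero => exact pow_zero A ▸ one (by simp)
  | succ n ih =>
    rw [pow_succ]
    refine ih.mul hA fun a ha b hb => ?_
    simp only [Set.mem_Ici] at *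
    push_cast
    linarith

theorem pow_Ici_zero (hA : SuppIn (Set.Ici 0) A) (n : ℕ) : SuppIn (Set.Ici 0) (A ^ n) :=
  (hA.pow_Ici n).mono (by simp)

end SuppIn

/-! ### The matrices of Γ and Γ⁻¹ and their polynomial identities -/

instance laurentCharTwo : CharP (ZMod 2)[T;T⁻¹] 2 :=
  charP_of_injective_ringHom (f := (C : ZMod 2 →+* (ZMod 2)[T;T⁻¹]))
    (fun a b h => by simpa using congrArg (fun p : (ZMod 2)[T;T⁻¹] => p.coeff 0) h) 2

/-- The square matrices of size three over the Laurent polynomials with coefficients `ℤ/2`. -/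
abbrev LMat := Matrix (Fin 3) (Fin 3) (ZMod 2)[T;T⁻¹]

/-- The matrix of `Γ`. -/
def gMat : LMat := !![0, 0, 1; 0, 1, T 1; 1, T 1, 0]

/-- The matrix of `Γ⁻¹`. -/
def dMat : LMat := !![T 2, T 1, 1; T 1, 1, 0; 1, 0, 0]

theorem lMat_add_self (A : LMat) : A + A = 0 := CharTwo.add_self_eq_zero A

theorem lMat_eq_add_add (A B : LMat) : A = B + (A + B) := by
  rw [add_comm A, ← add_assoc, lMat_add_self, zero_add]

theorem two_eq_zero_laurent : (2 : (ZMod 2)[T;T⁻¹]) = 0 := CharTwo.two_eq_zero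

theorem T_eq_pow (n : ℕ) : (T n : (ZMod 2)[T;T⁻¹]) = T 1 ^ n := by simp

theorem dMat_eq : dMat = !![T 1 ^ 2, T 1, 1; T 1, 1, 0; 1, 0, 0] := by
  rw [dMat, ← T_eq_pow 2]; rfl

theorem gMat_mul_dMat : gMat * dMat = 1 := by
  have h2 := two_eq_zero_laurent
  rw [gMat, dMat_eq]
  generalize (T 1 : (ZMod 2)[T;T⁻¹]) = u at *
  ext1 i j
  fin_cases i <;> fin_cases j <;> simp [Matrix.mul_apply, Fin.sum_univ_three] <;> grind

theorem dMat_mul_gMat : dMat * gMat = 1 := by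
  have h2 := two_eq_zero_laurent
  rw [gMat, dMat_eq]
  generalize (T 1 : (ZMod 2)[T;T⁻¹]) = u at *
  ext1 i j
  fin_cases i <;> fin_cases j <;> simp [Matrix.mul_apply, Fin.sum_univ_three] <;> grind

theorem dMat_sq_add_one : dMat ^ 2 + 1 = !![T 1 ^ 4 + T 1 ^ 2, T 1 ^ 3 + T 1, T 1 ^ 2;
    T 1 ^ 3 + T 1, T 1 ^ 2, T 1; T 1 ^ 2, T 1, 0] := by
  have h2 := two_eq_zero_laurent
  rw [dMat_eq]
  generalize (T 1 : (ZMod 2)[T;T⁻¹]) = u at *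
  ext1 i j
  fin_cases i <;> fin_cases j <;> simp [pow_two] <;> grind

theorem dMat_cube : dMat ^ 3 = (T 1 ^ 4 : (ZMod 2)[T;T⁻¹]) • dMat +
    !![T 1 ^ 2, 0, T 1 ^ 2 + 1; 0, 1, T 1 ^ 3 + T 1; T 1 ^ 2 + 1, T 1 ^ 3 + T 1, T 1 ^ 2] := by
  have h2 := two_eq_zero_laurent
  have h3 : dMat ^ 3 = dMat * (dMat ^ 2 + 1) + dMat := by 
    rw [mul_add, mul_one, add_assoc, lMat_add_self, add_zero, pow_succ' _ 2]
  rw [h3, dMat_sq_add_one, dMat_eq]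
  generalize (T 1 : (ZMod 2)[T;T⁻¹]) = u at *
  ext1 i j
  fin_cases i <;> fin_cases j <;> simp <;> grind

theorem gMat_cube :
    gMat ^ 3 = gMat ^ 2 + (1 + T 1 ^ 2 : (ZMod 2)[T;T⁻¹]) • gMat + 1 := by
  have h2 := two_eq_zero_laurent
  rw [gMat]
  generalize (T 1 : (ZMod 2)[T;T⁻¹]) = u at *
  ext1 i j
  fin_cases i <;> fin_cases j <;>
    simp [pow_succ, Matrix.mul_apply, Fin.sum_univ_three] <;> grind

/-- This cubic relation drives the self-similarity: a fourth power of X = D² + 1 gains a factor u⁴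
and retains a factor X. -/
theorem dMat_sq_add_one_cube :
    (dMat ^ 2 + 1) ^ 3 = (T 1 ^ 4 : (ZMod 2)[T;T⁻¹]) • ((dMat ^ 2 + 1) ^ 2 + 1) := by
  have h2 := two_eq_zero_laurent
  rw [dMat_sq_add_one]
  generalize (T 1 : (ZMod 2)[T;T⁻¹]) = u at *
  ext1 i j
  fin_cases i <;> fin_cases j <;>
    simp [pow_succ] <;> grind

theorem coeff_T_one_pow (n : ℕ) (k : ℤ) :
    (T 1 ^ n : (ZMod 2)[T;T⁻¹]).coeff k = if (n : ℤ) = k then 1 else 0 := by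
  rw [← T_eq_pow, T_apply]

theorem coeff_one_laurent (k : ℤ) :
    (1 : (ZMod 2)[T;T⁻¹]).coeff k = if (0 : ℤ) = k then 1 else 0 := by
  rw [← T_zero, T_apply]

theorem gMat_suppIn : SuppIn (Set.Icc 0 1) gMat := by
  intro i j k
  fin_cases i <;> fin_cases j <;> simp [gMat, coeff_one_laurent] <;> omega

theorem dMat_suppIn : SuppIn (Set.Icc 0 2) dMat := by
  intro i j k
  fin_cases i <;> fin_cases j <;> simp [dMat, coeff_one_laurent] <;> omega

theorem dMat_sq_add_one_suppIn : SuppIn (Set.Ici 1) (dMat ^ 2 + 1) := by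
  rw [dMat_sq_add_one]
  intro i j k
  contrapose!
  intro hk
  simp only [Set.mem_Ici, not_le] at hk
  fin_cases i <;> fin_cases j <;>
    simp [-T_pow, coeff_T_one_pow] <;> (repeat rw [if_neg (by omega)]) <;> try simp
  all_goals omega

theorem gMat_pow_suppIn (n : ℕ) : SuppIn (Set.Icc 0 n) (gMat ^ n) := by
  intro i j k hk
  have h0 := (gMat_suppIn.mono Set.Icc_subset_Ici_self).pow_Ici_zero n i j k hk
  have h1 := (gMat_suppIn.mono Set.Icc_subset_Iic_self).pow_Iic n i j k hk
  simp only [Set.mem_Ici, Set.mem_Iic, Set.mem_Icc] at *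
  omega

theorem dMat_pow_suppIn (n : ℕ) : SuppIn (Set.Icc 0 (2 * n)) (dMat ^ n) := by
  intro i j k hk
  have h0 := (dMat_suppIn.mono Set.Icc_subset_Ici_self).pow_Ici_zero n i j k hk
  have h1 := (dMat_suppIn.mono Set.Icc_subset_Iic_self).pow_Iic n i j k hk
  simp only [Set.mem_Ici, Set.mem_Iic, Set.mem_Icc] at *
  omega

theorem gMat_pow_mul_dMat_pow (n : ℕ) : gMat ^ n * dMat ^ n = 1 := by
  have h : Commute gMat dMat := gMat_mul_dMat.trans dMat_mul_gMat.symm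
  rw [← h.mul_pow, gMat_mul_dMat, one_pow]

theorem dMat_pow_mul_gMat_pow (n : ℕ) : dMat ^ n * gMat ^ n = 1 := by
  have h : Commute dMat gMat := dMat_mul_gMat.trans gMat_mul_dMat.symm
  rw [← h.mul_pow, dMat_mul_gMat, one_pow]

/-! ### Powers of exponent 2^n near the identity, and the gaps they create -/

theorem add_one_pow_two_pow (A : LMat) (n : ℕ) : (A + 1) ^ 2 ^ n = A ^ 2 ^ n + 1 := by
  rw [add_pow_char_pow_of_commute 2 n (Commute.one_right A), one_pow]

/-- With X = D² + 1, X⁴ = u⁴ X (X² + 1), and taking 4^j-th powers shows that the lowest exponent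
grows as the sum of 1, 4, ..., 4^j. -/
theorem dMat_sq_add_one_pow_suppIn (j : ℕ) :
    ∃ c : ℤ, 3 * c + 1 = 4 ^ (j + 1) ∧ SuppIn (Set.Ici c) ((dMat ^ 2 + 1) ^ 4 ^ j) := by
  have h0 := dMat_sq_add_one_suppIn
  induction j with
  | zero => exact ⟨1, by norm_num, by simpa using h0⟩
  | succ j ih =>
    obtain ⟨c, hc, h⟩ := ih
    refine ⟨4 ^ (j + 1) + c, by rw [pow_succ _ (j + 1)]; linarith, ?_⟩
    have h4 : (dMat ^ 2 + 1) ^ 4 ^ (j + 1) = (T (4 ^ (j + 1)) : (ZMod 2)[T;T⁻¹]) •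
        ((dMat ^ 2 + 1) ^ 4 ^ j * ((dMat ^ 2 + 1) ^ 2 + 1) ^ 4 ^ j) := by
      have e : (dMat ^ 2 + 1) ^ 4 = (T 4 : (ZMod 2)[T;T⁻¹]) •
          ((dMat ^ 2 + 1) * ((dMat ^ 2 + 1) ^ 2 + 1)) := by
        rw [pow_succ' _ 3, dMat_sq_add_one_cube, mul_smul_comm, ← T_eq_pow 4]
        rfl
      have hcomm : Commute (dMat ^ 2 + 1) ((dMat ^ 2 + 1) ^ 2 + 1) :=
        ((Commute.refl _).pow_right 2).add_right (Commute.one_right _)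
      rw [pow_succ' 4 j, pow_mul, e, smul_pow, hcomm.mul_pow, T_pow]
      norm_num [pow_succ]
    rw [h4]
    have h5 : SuppIn (Set.Ici 0) ((dMat ^ 2 + 1) ^ 2 + 1) :=
      ((h0.mono (Set.Ici_subset_Ici.2 zero_le_one)).pow_Ici_zero 2).add (SuppIn.one (by simp))
    refine (h.mul (h5.pow_Ici_zero _) (r := Set.Ici c) ?_).T_smul _ ?_ <;>
      simp only [Set.mem_Ici] <;> intros <;> linarith

/-- The power `Γ ^ (-2 ^ n)` agrees with the identity up to the exponent `(2/3) 2 ^ n`. -/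
theorem dMat_pow_two_pow_suppIn (n : ℕ) :
    ∃ c : ℤ, 2 * 2 ^ n ≤ 3 * c + 2 ∧ SuppIn (Set.Ici c) (dMat ^ 2 ^ n + 1) := by
  have hd : ∀ n : ℕ, SuppIn (Set.Ici 0) (dMat ^ n) := fun n =>
    (dMat_suppIn.mono Set.Icc_subset_Ici_self).pow_Ici_zero n
  have h4 (j : ℕ) : (4 : ℕ) ^ j = 2 ^ (2 * j) := by rw [pow_mul]; norm_num
  have h4' (j : ℕ) : (4 : ℤ) ^ j = 2 ^ (2 * j) := by rw [pow_mul]; norm_num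
  have key (j : ℕ) : (dMat ^ 2 + 1) ^ 4 ^ j = dMat ^ 2 ^ (2 * j + 1) + 1 := by
    rw [h4, add_one_pow_two_pow, ← pow_mul, ← pow_succ']
  rcases Nat.even_or_odd' n with ⟨j, rfl | rfl⟩
  · rcases j with _ | j
    · exact ⟨0, by norm_num, (hd _).add (SuppIn.one (by simp))⟩
    · obtain ⟨c, hc, h⟩ := dMat_sq_add_one_pow_suppIn j
      refine ⟨2 * c, ?_, ?_⟩
      · rw [h4'] at hc
        linarith
      · rw [key] at h
        have := h.pow_Ici 2
        rw [show dMat ^ 2 ^ (2 * (j + 1)) + 1 = (dMat ^ 2 ^ (2 * j + 1) + 1) ^ 2 ^ 1 by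
          rw [add_one_pow_two_pow, ← pow_mul, ← pow_add]; rfl]
        simpa using this
  · obtain ⟨c, hc, h⟩ := dMat_sq_add_one_pow_suppIn j
    refine ⟨c, ?_, key j ▸ h⟩
    rw [h4', mul_add, mul_one, pow_add, pow_two] at hc
    rw [pow_succ]
    linarith

/-- G^N + 1 = G^N (D^N + 1), and G^N has only nonnegative exponents. -/
theorem gMat_pow_two_pow_suppIn (n : ℕ) :
    ∃ c : ℤ, 2 * 2 ^ n ≤ 3 * c + 2 ∧ SuppIn (Set.Ici c) (gMat ^ 2 ^ n + 1) := by
  obtain ⟨c, hc, h⟩ := dMat_pow_two_pow_suppIn n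
  refine ⟨c, hc, ?_⟩
  have e : gMat ^ 2 ^ n + 1 = gMat ^ 2 ^ n * (dMat ^ 2 ^ n + 1) := by
    rw [mul_add, gMat_pow_mul_dMat_pow, mul_one, add_comm]
  rw [e]
  refine (gMat_pow_suppIn _).mul h ?_
  simp only [Set.mem_Icc, Set.mem_Ici]
  intros
  linarith

/-- The coefficients of `Γ ^ (-b)` vanish in the triangle at scale `2 ^ n`. -/
theorem coeff_dMat_pow_eq_zero {n b : ℕ} {a : ℤ} (h1 : 2 ^ n - a < b)
    (h2 : (2 * b : ℤ) < 2 * 2 ^ n + a) (h3 : 3 * a + 3 ≤ 2 * 2 ^ n) (i j : Fin 3) :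
    ((dMat ^ b) i j).coeff a = 0 := by
  obtain ⟨c, hc, h⟩ := dMat_pow_two_pow_suppIn n
  -- With N = 2^n, either D^(N+t) = D^t + O(u^c) or D^(N-t) = G^t + O(u^c). The first term has
  -- degree at most 2t, respectively t, and `a` lies strictly between that degree and `c`.
  rcases le_total (2 ^ n) b with hb | hb
  · obtain ⟨t, rfl⟩ := Nat.exists_eq_add_of_le hb
    have e : dMat ^ (2 ^ n + t) = dMat ^ t + (dMat ^ 2 ^ n + 1) * dMat ^ t := by
      rw [add_mul, one_mul, ← pow_add, ← lMat_eq_add_add]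
    have hs : SuppIn {k | k ≤ 2 * t ∨ c ≤ k} (dMat ^ (2 ^ n + t)) := by
      rw [e]
      refine ((dMat_pow_suppIn t).mono fun k hk => Or.inl hk.2).add
        (h.mul (dMat_pow_suppIn t) ?_)
      simp only [Set.mem_Icc, Set.mem_Ici]
      intros
      right
      linarith
    refine hs.coeff_eq_zero ?_ i j
    push_cast at h1 h2
    simp only [Set.mem_ofPred_eq]
    omega
  · obtain ⟨t, ht⟩ := Nat.exists_eq_add_of_le hb
    have e : dMat ^ b = gMat ^ t + (dMat ^ 2 ^ n + 1) * gMat ^ t := by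
      rw [add_mul, one_mul, ht, pow_add, mul_assoc, dMat_pow_mul_gMat_pow, mul_one,
        ← lMat_eq_add_add]
    have hs : SuppIn {k | k ≤ t ∨ c ≤ k} (dMat ^ b) := by
      rw [e]
      refine ((gMat_pow_suppIn t).mono fun k hk => Or.inl hk.2).add
        (h.mul (gMat_pow_suppIn t) ?_)
      simp only [Set.mem_Icc, Set.mem_Ici]
      intros
      right
      linarith
    refine hs.coeff_eq_zero ?_ i j
    have ht' : (2 : ℤ) ^ n = b + t := by exact_mod_cast ht
    simp only [Set.mem_ofPred_eq]
    omega

/-! ### Places where powers of Γ act locally as a shift -/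

/-- Near the exponent `x`, at distance at most `w`, the matrix `A` agrees with `u ^ x`. -/
def AgreesNear (x w : ℤ) (A : LMat) : Prop :=
  SuppIn {k | k < x - w ∨ x + w < k} (A + (T x : (ZMod 2)[T;T⁻¹]) • 1)

theorem coeff_T_smul_one (x k : ℤ) (i j : Fin 3) :
    ((((T x : (ZMod 2)[T;T⁻¹]) • (1 : LMat)) i j).coeff k : ZMod 2) =
      if x = k then (1 : Matrix (Fin 3) (Fin 3) (ZMod 2)) i j else 0 := by
  by_cases h : i = j
  · subst h
    simp
  · simp [Matrix.one_apply_ne h]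

theorem AgreesNear.coeff_eq {x w k : ℤ} {A : LMat} (h : AgreesNear x w A) (h1 : x - w ≤ k)
    (h2 : k ≤ x + w) (i j : Fin 3) :
    (A i j).coeff k = if x = k then (1 : Matrix (Fin 3) (Fin 3) (ZMod 2)) i j else 0 := by
  have h0 := h.coeff_eq_zero (k := k) (by simp [h1, h2]) i j
  rw [Matrix.add_apply, AddMonoidAlgebra.coeff_add, Finsupp.add_apply, coeff_T_smul_one] at h0
  exact CharTwo.add_eq_zero.1 h0

/-- If `A` agrees with `u ^ x` near `x`, and `B` is a polynomial matrix agreeing with the identity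
near `0`, then `A * B` agrees with `u ^ x` near `x`. -/
theorem AgreesNear.mul {x w e v w' : ℤ} {A B : LMat} (hA : AgreesNear x w A)
    (hB : SuppIn (Set.Icc 0 e) B) (hB' : SuppIn (Set.Ici v) (B + 1)) (h1 : w' + e ≤ w)
    (h2 : w' < v) : AgreesNear x w' (A * B) := by
  have e : A * B + (T x : (ZMod 2)[T;T⁻¹]) • 1 =
      (A + (T x : (ZMod 2)[T;T⁻¹]) • 1) * B + (T x : (ZMod 2)[T;T⁻¹]) • (B + 1) := by
    rw [add_mul, smul_add, smul_mul_assoc, one_mul, add_assoc, ← add_assoc (_ • B),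
      lMat_add_self, zero_add]
  unfold AgreesNear
  rw [e]
  refine (SuppIn.mul hA hB ?_).add (hB'.T_smul x ?_)
  · simp only [Set.mem_Icc, Set.mem_ofPred_eq]
    intros
    omega
  · simp only [Set.mem_Ici, Set.mem_ofPred_eq]
    intros
    omega

/-- If `u ^ (-x) Y = X + Z` where `X` and `Z` commute, `Z` has negative degree, and `X ^ N` agrees
with the identity up to the exponent `c`, then `Y ^ N` agrees with `u ^ (x N)` near `x N`. -/
theorem agreesNear_pow {X Y : LMat} {x c w : ℤ} {n : ℕ} (hc : Commute X Y)
    (hZ : SuppIn (Set.Iic (-1)) ((T (-x) : (ZMod 2)[T;T⁻¹]) • Y + X))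
    (hX : SuppIn (Set.Ici c) (X ^ 2 ^ n + 1)) (h1 : w < 2 ^ n) (h2 : w < c) :
    AgreesNear (x * 2 ^ n) w (Y ^ 2 ^ n) := by
  have hpow : Y ^ 2 ^ n + (T (x * 2 ^ n) : (ZMod 2)[T;T⁻¹]) • 1 =
      (T (x * 2 ^ n) : (ZMod 2)[T;T⁻¹]) •
        ((X ^ 2 ^ n + 1) + ((T (-x) : (ZMod 2)[T;T⁻¹]) • Y + X) ^ 2 ^ n) := by
    have hY : (T (x * 2 ^ n) : (ZMod 2)[T;T⁻¹]) • ((T (-x) : (ZMod 2)[T;T⁻¹]) • Y) ^ 2 ^ n =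
        Y ^ 2 ^ n := by
      rw [smul_pow, smul_smul, T_pow, ← T_add]
      have : x * 2 ^ n + ((2 ^ n : ℕ) : ℤ) * -x = 0 := by
        push_cast
        ring
      rw [this, T_zero, one_smul]
    rw [add_pow_char_pow_of_commute 2 n ((hc.symm).smul_left _), add_comm (_ ^ 2 ^ n) (X ^ 2 ^ n),
      add_comm (X ^ 2 ^ n) 1, add_assoc, ← add_assoc (X ^ 2 ^ n), lMat_add_self, zero_add,
      smul_add, hY, add_comm]
  unfold AgreesNear
  rw [hpow]
  refine SuppIn.T_smul (s := {k | c ≤ k ∨ k ≤ -2 ^ n}) _ ((hX.mono ?_).add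
    ((hZ.pow_Iic _).mono ?_)) ?_
  · exact fun k hk => Or.inl hk
  · intro k hk
    right
    simpa using hk
  · simp only [Set.mem_ofPred_eq]
    intros
    omega

/-- If P has degree at most 0 and fixes X up to negative degree, so do its powers. This propagates
one leading-term identity along a whole direction of space-time. -/
theorem suppIn_Iic_of_step {X P : LMat} (hP : SuppIn (Set.Iic 0) P)
    (h : SuppIn (Set.Iic (-1)) (P * X + X)) (q : ℕ) :
    SuppIn (Set.Iic (-1)) (P ^ q * X + X) := by
  induction q with
  | zero =>
    rw [pow_zero, one_mul, lMat_add_self]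
    intro i j k hk
    simp at hk
  | succ q ih =>
    have e : P ^ (q + 1) * X + X = P * (P ^ q * X + X) + (P * X + X) := by
      rw [mul_add, ← mul_assoc, ← pow_succ', add_assoc, ← add_assoc (P * X), lMat_add_self,
        zero_add]
    rw [e]
    refine (hP.mul ih ?_).add h
    simp only [Set.mem_Iic]
    intros
    omega

theorem gMat_step_suppIn :
    SuppIn (Set.Iic (-1)) (((T (-4) : (ZMod 2)[T;T⁻¹]) • gMat ^ 4) * gMat + gMat) := by
  have h2 := two_eq_zero_laurent
  -- The cubic relation of G gives G⁵ = u⁴ G + terms of degree at most 3: four time steps move the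
  -- top part of G by four cells.
  have e : gMat ^ 5 + (T 4 : (ZMod 2)[T;T⁻¹]) • gMat =
      gMat + (T 2 : (ZMod 2)[T;T⁻¹]) • (gMat + 1) := by
    have h4 : gMat ^ 4 = (T 1 ^ 2 : (ZMod 2)[T;T⁻¹]) • (gMat ^ 2 + gMat) + 1 := by
      rw [pow_succ' _ 3, gMat_cube, mul_add, mul_add, mul_one, mul_smul_comm, ← pow_succ', gMat_cube,
        ← pow_two]
      generalize gMat ^ 2 = G
      ext1 i j
      simp only [Matrix.add_apply, Matrix.smul_apply, smul_eq_mul]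
      grind
    have h5 : gMat ^ 5 = (T 1 ^ 2 : (ZMod 2)[T;T⁻¹]) • (gMat ^ 3 + gMat ^ 2) + gMat := by
      rw [pow_succ' _ 4, h4, mul_add, mul_one, mul_smul_comm, mul_add, ← pow_succ', ← pow_two]
    rw [h5, gMat_cube, show (T 4 : (ZMod 2)[T;T⁻¹]) = T 1 ^ 4 from T_eq_pow 4,
      show (T 2 : (ZMod 2)[T;T⁻¹]) = T 1 ^ 2 from T_eq_pow 2]
    generalize gMat ^ 2 = G
    ext1 i j
    simp only [Matrix.add_apply, Matrix.smul_apply, smul_eq_mul]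
    grind
  have e' : ((T (-4) : (ZMod 2)[T;T⁻¹]) • gMat ^ 4) * gMat + gMat =
      (T (-4) : (ZMod 2)[T;T⁻¹]) • (gMat + (T 2 : (ZMod 2)[T;T⁻¹]) • (gMat + 1)) := by
    rw [← e, smul_add, smul_smul, ← T_add, smul_mul_assoc, ← pow_succ]
    norm_num
  rw [e']
  have hg : SuppIn (Set.Iic 1) gMat := gMat_suppIn.mono Set.Icc_subset_Iic_self
  refine SuppIn.T_smul (s := Set.Iic 3) _ ((hg.mono ?_).add
    ((hg.add (SuppIn.one (by simp))).T_smul 2 ?_)) ?_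
  · exact Set.Iic_subset_Iic.2 (by norm_num)
  all_goals
    simp only [Set.mem_Iic]
    intros
    omega

/-- D³ = u⁴ D + terms of degree at most 3: two time steps move the top part of D by four cells, the
maximal speed of Γ⁻¹. -/
theorem dMat_step_suppIn :
    SuppIn (Set.Iic (-1)) (((T (-4) : (ZMod 2)[T;T⁻¹]) • dMat ^ 2) * dMat + dMat) := by
  have e' : ((T (-4) : (ZMod 2)[T;T⁻¹]) • dMat ^ 2) * dMat + dMat =
      (T (-4) : (ZMod 2)[T;T⁻¹]) • !![T 1 ^ 2, 0, T 1 ^ 2 + 1; 0, 1, T 1 ^ 3 + T 1;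
        T 1 ^ 2 + 1, T 1 ^ 3 + T 1, T 1 ^ 2] := by
    rw [smul_mul_assoc, ← pow_succ, dMat_cube, smul_add, smul_smul, ← T_eq_pow, ← T_add, add_comm,
      Nat.cast_ofNat, neg_add_cancel, T_zero, one_smul, ← add_assoc, lMat_add_self, zero_add]
  rw [e']
  refine SuppIn.T_smul (s := Set.Iic 3) _ ?_ ?_
  · intro i j k
    contrapose!
    intro hk
    simp only [Set.mem_Iic, not_le] at hk
    fin_cases i <;> fin_cases j <;>
      simp [-T_pow, coeff_T_one_pow, coeff_one_laurent] <;>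
      (repeat rw [if_neg (by omega)]) <;> try simp
    all_goals omega
  · simp only [Set.mem_Iic]
    intros
    omega

/-- u^(-4q) G^(4q+1) is G plus negative degree. Its 2^n-th power is G^(2^n) plus degree at most
-2^n, hence 1 on a window; a half-width of a quarter of 2^n stays below both bounds. -/
theorem gMat_agreesNear_diagonal (q n : ℕ) {w : ℤ} (hw : 0 < w) (hn : 4 * w = 2 ^ n) :
    AgreesNear (4 * q * 2 ^ n) w (gMat ^ ((4 * q + 1) * 2 ^ n)) := by
  obtain ⟨c, hc, h⟩ := gMat_pow_two_pow_suppIn n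
  rw [pow_mul]
  have hP : SuppIn (Set.Iic 0) ((T (-4) : (ZMod 2)[T;T⁻¹]) • gMat ^ 4) := by
    refine (gMat_pow_suppIn 4).T_smul _ ?_
    simp only [Set.mem_Icc, Set.mem_Iic, Nat.cast_ofNat]
    intros
    omega
  refine agreesNear_pow (Commute.self_pow _ _) ?_ h (by omega) (by omega)
  have := suppIn_Iic_of_step hP gMat_step_suppIn q
  rwa [smul_pow, ← pow_mul, smul_mul_assoc, ← pow_succ, T_pow,
    show ((q : ℤ) * -4) = -(4 * q) by ring] at this

theorem dMat_agreesNear_edge (q n : ℕ) {w : ℤ} (hw : 0 < w) (hn : 4 * w = 2 ^ n) :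
    AgreesNear (4 * q * 2 ^ n) w (dMat ^ ((2 * q + 1) * 2 ^ n)) := by
  obtain ⟨c, hc, h⟩ := dMat_pow_two_pow_suppIn n
  rw [pow_mul]
  have hP : SuppIn (Set.Iic 0) ((T (-4) : (ZMod 2)[T;T⁻¹]) • dMat ^ 2) := by
    refine (dMat_pow_suppIn 2).T_smul _ ?_
    simp only [Set.mem_Icc, Set.mem_Iic, Nat.cast_ofNat]
    intros
    omega
  refine agreesNear_pow (Commute.self_pow _ _) ?_ h (by omega) (by omega)
  have := suppIn_Iic_of_step hP dMat_step_suppIn q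
  rwa [smul_pow, ← pow_mul, smul_mul_assoc, ← pow_succ, T_pow,
    show ((q : ℤ) * -4) = -(4 * q) by ring] at this

/-- With b = (2q+1)2^n, G^(2^(j+n) - b) = G^(2^(j+n)) D^b = D^b + O(u^c), so the edge pattern of D
survives at time 2^(j+n) - b. The bound on `q` keeps the window below `c`, about (2/3)2^(j+n), which
explains the abscissa 2/3 of the end of the segment. -/
theorem gMat_agreesNear_segment (q j n : ℕ) {w : ℤ} (hw : 0 < w) (hn : 4 * w = 2 ^ n)
    (hq : 12 * q + 12 ≤ 2 * 2 ^ j) :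
    AgreesNear (4 * q * 2 ^ n) w (gMat ^ ((2 ^ j - (2 * q + 1)) * 2 ^ n)) := by
  obtain ⟨c, hc, h⟩ := gMat_pow_two_pow_suppIn (j + n)
  obtain ⟨r, hr⟩ := Nat.exists_eq_add_of_le (show 2 * q + 1 ≤ 2 ^ j by omega)
  have hd := dMat_agreesNear_edge q n hw hn
  have e : gMat ^ ((2 ^ j - (2 * q + 1)) * 2 ^ n) + (T (4 * q * 2 ^ n) : (ZMod 2)[T;T⁻¹]) • 1 =
      (dMat ^ ((2 * q + 1) * 2 ^ n) + (T (4 * q * 2 ^ n) : (ZMod 2)[T;T⁻¹]) • 1) +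
        (gMat ^ 2 ^ (j + n) + 1) * dMat ^ ((2 * q + 1) * 2 ^ n) := by
    have e1 : gMat ^ ((2 ^ j - (2 * q + 1)) * 2 ^ n) =
        gMat ^ 2 ^ (j + n) * dMat ^ ((2 * q + 1) * 2 ^ n) := by
      have e2 : 2 ^ (j + n) = r * 2 ^ n + (2 * q + 1) * 2 ^ n := by
        rw [pow_add, hr]
        ring
      rw [e2, pow_add, mul_assoc, gMat_pow_mul_dMat_pow, mul_one, hr, Nat.add_sub_cancel_left]
    rw [e1]
    generalize dMat ^ ((2 * q + 1) * 2 ^ n) = B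
    rw [add_mul, one_mul, add_comm B, add_assoc, ← lMat_eq_add_add, add_comm]
  unfold AgreesNear
  rw [e]
  refine SuppIn.add hd ((h.mul (dMat_pow_suppIn _) (r := Set.Ici c) ?_).mono ?_)
  · simp only [Set.mem_Ici, Set.mem_Icc]
    intros
    omega
  · intro k hk
    right
    have hk : c ≤ k := hk
    have hq' : (12 * q + 12) * (2 : ℤ) ^ n ≤ 2 * 2 ^ j * 2 ^ n :=
      mul_le_mul_of_nonneg_right (by exact_mod_cast hq) (by positivity)
    rw [pow_add] at hc
    nlinarith

theorem gMat_suppIn_multiple (r n : ℕ) :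
    ∃ c : ℤ, 2 * 2 ^ n ≤ 3 * c + 2 ∧ SuppIn (Set.Ici c) (gMat ^ (r * 2 ^ n) + 1) := by
  obtain ⟨c, hc, h⟩ := gMat_pow_two_pow_suppIn n
  refine ⟨c, hc, ?_⟩
  induction r with
  | zero =>
    rw [Nat.zero_mul, pow_zero, lMat_add_self]
    intro i j k hk
    simp at hk
  | succ r ih =>
    have e : gMat ^ ((r + 1) * 2 ^ n) + 1 =
        (gMat ^ (r * 2 ^ n) + 1) * gMat ^ 2 ^ n + (gMat ^ 2 ^ n + 1) := by
      rw [Nat.succ_mul, pow_add]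
      generalize gMat ^ 2 ^ n = B
      rw [add_mul, one_mul, add_assoc, ← add_assoc B, lMat_add_self, zero_add]
    rw [e]
    refine (ih.mul (gMat_pow_suppIn _) ?_).add h
    simp only [Set.mem_Ici, Set.mem_Icc]
    intros
    omega

theorem gMat_agreesNear_axis (r n : ℕ) {w : ℤ} (hw : 0 < w) (hn : 4 * w = 2 ^ n) :
    AgreesNear 0 w (gMat ^ (r * 2 ^ n)) := by
  obtain ⟨c, hc, h⟩ := gMat_suppIn_multiple r n
  unfold AgreesNear
  rw [T_zero, one_smul]
  refine h.mono fun k hk => ?_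
  simp only [Set.mem_Ici, Set.mem_ofPred_eq] at *
  omega

/-! ### Iterates, rescalings and mirror images of cellular automata -/

namespace CellularAutomaton

section General

variable {A B : Type*} [Finite A] [Finite B]

theorem iter_add_apply (F : CellularAutomaton A) (s t : ℕ) (c : ℤ → A) :
    F.iter (s + t) c = F.iter s (F.iter t c) := by
  simp only [iter_apply, Function.iterate_add_apply]

theorem iter_succ_apply (F : CellularAutomaton A) (t : ℕ) (c : ℤ → A) :
    F.iter (t + 1) c = F.iter t (F c) := rfl

theorem apply_shift (F : CellularAutomaton A) (z : ℤ) (c : ℤ → A) (x : ℤ) :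
    F (shift z c) x = F c (x - z) := by
  obtain ⟨N, f, hf⟩ := F.isLocal
  rw [hf, hf]
  congr 1
  funext i
  change c (x + i - z) = c (x - z + i)
  congr 1
  ring

theorem iter_shift (F : CellularAutomaton A) (t : ℕ) (z : ℤ) (c : ℤ → A) (x : ℤ) :
    F.iter t (shift z c) x = F.iter t c (x - z) := apply_shift (F.iter t) z c x

/-- F commutes with shifts, so Y rescaled steps amount to tY steps of F with an accumulated shift
zY. -/
theorem rescale_iter (F : CellularAutomaton A) (m t : ℕ+) (z : ℤ) (Y : ℕ) (e : ℤ → Fin m → A)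
    (X : ℤ) (j : Fin m) :
    (F.rescale m t z).iter Y e X j =
      F.iter (t * Y) ((pack A m).symm e) (m * X + (j : ℕ) - z * Y) := by
  induction Y generalizing e with
  | zero =>
    simp only [mul_zero, Nat.cast_zero, sub_zero]
    change e X j = (pack A m).symm e (m * X + (j : ℕ))
    conv_lhs => rw [← (pack A m).apply_symm_apply e]
    rfl
  | succ Y ih =>
    have h : (pack A m).symm (F.rescale m t z e) = shift z (F.iter t ((pack A m).symm e)) :=
      (pack A m).symm_apply_apply _
    rw [iter_succ_apply, ih, h, iter_shift, ← iter_add_apply, Nat.mul_succ]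
    congr 1
    push_cast
    ring

theorem mirror_iter (F : CellularAutomaton A) (t : ℕ) (c : ℤ → A) (x : ℤ) :
    F.mirror.iter t c x = F.iter t (fun y => c (-y)) (-x) := by
  induction t generalizing c with
  | zero =>
    change c x = c (- -x)
    rw [neg_neg]
  | succ t ih =>
    rw [iter_succ_apply, iter_succ_apply, ih]
    congr 1
    funext y
    change F (fun y => c (-y)) (- -y) = _
    rw [neg_neg]

theorem green_comp {F : CellularAutomaton A} {G : CellularAutomaton B} {φ : A → B}
    (hφ : ∀ c : ℤ → A, φ ∘ F c = G (φ ∘ c)) (x : ℤ) (y : ℕ) (c : ℤ → A) (q : A) :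
    G.green x y (φ ∘ c) (φ q) = φ (F.green x y c q) := by
  have h : ∀ c : ℤ → A, φ ∘ F.iter y c = G.iter y (φ ∘ c) := by
    induction y with
    | zero => exact fun c => rfl
    | succ y ih => exact fun c => by rw [iter_succ_apply, iter_succ_apply, ih, hφ]
  simp only [green]
  rw [← Function.comp_update, ← h]
  rfl

end General

/-! ### Superposition kernels of linear automata -/

section Kernel

variable {R : Type*} [CommRing R] {d : ℕ}

/-- The action of Laurent polynomials on sequences, the indeterminate acting as the shift. -/
def laurentAct (R : Type*) [CommRing R] : R[T;T⁻¹] →ₐ[R] Module.End R (ℤ → R) :=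
  AddMonoidAlgebra.lift R (Module.End R (ℤ → R)) ℤ
    { toFun := fun k =>
        { toFun := fun s x => s (x - k.toAdd)
          map_add' := fun _ _ => rfl
          map_smul' := fun _ _ => rfl }
      map_one' := by
        ext s x
        simp
      map_mul' := fun k l => by
        ext s x
        simp [sub_sub] }

theorem laurentAct_apply (p : R[T;T⁻¹]) (s : ℤ → R) (x : ℤ) :
    laurentAct R p s x = p.coeff.sum fun k a => a * s (x - k) := by
  rw [laurentAct, AddMonoidAlgebra.lift_apply]
  simp [Finsupp.sum]

theorem laurentAct_eq_sum (p : R[T;T⁻¹]) (e : ℤ → R) (s : Finset ℤ) (h : ∀ i ∉ s, e i = 0)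
    (x : ℤ) : laurentAct R p e x = ∑ i ∈ s, p.coeff (x - i) * e i := by
  classical
  have hinj : Set.InjOn (fun i => x - i) (s : Set ℤ) := fun a _ b _ hab => by
    simpa using hab
  rw [laurentAct_apply, Finsupp.sum_of_support_subset _
    (Finset.subset_union_left (s₂ := s.image fun i => x - i)) _ (by simp),
    ← Finset.sum_subset Finset.subset_union_right, Finset.sum_image hinj]
  · simp
  · intro k _ hk
    rw [h (x - k) fun hs => hk (Finset.mem_image.2 ⟨_, hs, by ring⟩), mul_zero]

variable [Finite R]

/-- A superposition principle: changing finitely many cells of the initial configuration changes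
the state at time `y` by a sum of translates of the matrices `K y`. -/
def HasKernel (F : CellularAutomaton (Fin d → R)) (K : ℕ → ℤ → Matrix (Fin d) (Fin d) R) : Prop :=
  ∀ (y : ℕ) (c c' : ℤ → Fin d → R) (s : Finset ℤ), (∀ i ∉ s, c i = c' i) → ∀ x,
    F.iter y c x = F.iter y c' x + ∑ i ∈ s, (K y (x - i)).mulVec (c i - c' i)

/-- Laurent polynomials act through an algebra homomorphism, so iterating the automaton is taking
powers of its matrix. -/
theorem linear_iter (M : Matrix (Fin d) (Fin d) R[T;T⁻¹]) (y : ℕ) (c : ℤ → Fin d → R) (x : ℤ)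
    (i : Fin d) :
    (linear M).iter y c x i = ∑ j, laurentAct R ((M ^ y) i j) (fun z => c z j) x := by
  induction y generalizing c with
  | zero =>
    rw [pow_zero, Finset.sum_eq_single i]
    · rw [Matrix.one_apply_eq, map_one]
      rfl
    · intro j _ hj
      rw [Matrix.one_apply_ne hj.symm, map_zero]
      rfl
    · simp
  | succ y ih =>
    rw [iter_succ_apply, ih]
    have h (j : Fin d) : (fun z => linear M c z j) =
        ∑ l, laurentAct R (M j l) (fun z => c z l) := by
      funext z
      rw [Finset.sum_apply]
      simp only [laurentAct_apply]
      rfl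
    simp only [h, map_sum, pow_succ, Matrix.mul_apply, map_mul, LinearMap.sum_apply,
      Finset.sum_apply]
    rw [Finset.sum_comm]
    rfl

theorem hasKernel_linear (M : Matrix (Fin d) (Fin d) R[T;T⁻¹]) :
    (linear M).HasKernel fun y k => Matrix.of fun i j => ((M ^ y) i j).coeff k := by
  intro y c c' s hs x
  funext i
  rw [Pi.add_apply, ← sub_eq_iff_eq_add', linear_iter, linear_iter, ← Finset.sum_sub_distrib,
    Finset.sum_apply]
  simp only [Matrix.mulVec, dotProduct, Matrix.of_apply]
  rw [Finset.sum_comm]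
  refine Finset.sum_congr rfl fun j _ => ?_
  rw [← Pi.sub_apply, ← map_sub, laurentAct_eq_sum _ _ s]
  · rfl
  · intro k hk
    simp [hs k hk]

theorem HasKernel.mirror {F : CellularAutomaton (Fin d → R)}
    {K : ℕ → ℤ → Matrix (Fin d) (Fin d) R} (h : F.HasKernel K) :
    F.mirror.HasKernel fun y k => K y (-k) := by
  classical
  intro y c c' s hs x
  rw [mirror_iter, mirror_iter, h y _ (fun y => c' (-y)) (s.image fun i => -i),
    Finset.sum_image neg_injective.injOn]
  · simp only [neg_neg]
    congr 2
    funext i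
    congr 2
    ring
  · intro i hi
    exact hs _ fun h => hi (Finset.mem_image.2 ⟨_, h, neg_neg i⟩)

theorem HasKernel.green_eq {F : CellularAutomaton (Fin d → R)}
    {K : ℕ → ℤ → Matrix (Fin d) (Fin d) R} (h : F.HasKernel K) (x : ℤ) (y : ℕ)
    (c : ℤ → Fin d → R) (q q' : Fin d → R) :
    F.green x y c q = F.green x y c q' + (K y x).mulVec (q - q') := by
  have := h y (Function.update c 0 q) (Function.update c 0 q') {0}
    (fun i hi => by simp at hi; simp [hi]) x
  simpa [green] using this

theorem HasKernel.concentrated {F : CellularAutomaton (Fin d → R)}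
    {K : ℕ → ℤ → Matrix (Fin d) (Fin d) R} (h : F.HasKernel K) {x : ℤ} {y l r : ℕ}
    (hx : K y x = 1) (hz : ∀ z ∈ Set.Icc (x - l) (x + r), z ≠ x → K y z = 0) :
    F.Concentrated x y l r := by
  refine ⟨fun c => Finite.injective_iff_bijective.1 fun q q' hq => ?_, fun c z hz' hne q q' => ?_⟩
  · have := h.green_eq x y c q q'
    rwa [hq, hx, Matrix.one_mulVec, left_eq_add, sub_eq_zero] at this
  · rw [h.green_eq z y c q q', hz z hz' hne, Matrix.zero_mulVec, add_zero]

theorem HasKernel.not_concentrated [Nontrivial (Fin d → R)] {F : CellularAutomaton (Fin d → R)}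
    {K : ℕ → ℤ → Matrix (Fin d) (Fin d) R} (h : F.HasKernel K) {x : ℤ} {y l r : ℕ}
    (hx : K y x = 0) : ¬ F.Concentrated x y l r := by
  intro hc
  obtain ⟨q, q', hne⟩ := exists_pair_ne (Fin d → R)
  refine hne ((hc.1 0).1 ?_)
  rw [h.green_eq x y 0 q q', hx, Matrix.zero_mulVec, add_zero]

theorem pack_symm_update {A : Type*} [Finite A] (m : ℕ+) (e : ℤ → Fin m → A) (q : Fin m → A)
    (i : Fin m) : (pack A m).symm (Function.update e 0 q) ((i : ℕ) : ℤ) = q i := by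
  have h := congrFun (congrFun ((pack A m).apply_symm_apply (Function.update e 0 q)) 0) i
  simpa [pack] using h

theorem pack_symm_update_of_notMem {A : Type*} [Finite A] (m : ℕ+) (e : ℤ → Fin m → A)
    (q : Fin m → A) {x : ℤ} (hx : ∀ i : Fin m, ((i : ℕ) : ℤ) ≠ x) :
    (pack A m).symm (Function.update e 0 q) x = (pack A m).symm e x := by
  have hm : (0 : ℤ) < (m : ℕ) := by exact_mod_cast m.pos
  have h0 : x / (m : ℕ) ≠ 0 := by
    intro h
    have h1 := Int.emod_nonneg x hm.ne'
    have h2 := Int.emod_lt_of_pos x hm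
    have h3 := Int.mul_ediv_add_emod x (m : ℕ)
    rw [h, mul_zero, zero_add] at h3
    exact hx ⟨x.toNat, by omega⟩ (by simp; omega)
  simp [pack, Function.update_of_ne h0]

theorem HasKernel.rescale_green_eq {F : CellularAutomaton (Fin d → R)}
    {K : ℕ → ℤ → Matrix (Fin d) (Fin d) R} (h : F.HasKernel K) (m t : ℕ+) (z X : ℤ) (Y : ℕ)
    (e : ℤ → Fin m → Fin d → R) (q q' : Fin m → Fin d → R) (j : Fin m) :
    (F.rescale m t z).green X Y e q j = (F.rescale m t z).green X Y e q' j +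
      ∑ i : Fin m, (K (t * Y) (m * X - z * Y + ((j : ℕ) - (i : ℕ)))).mulVec (q i - q' i) := by
  classical
  have hinj : Function.Injective fun i : Fin m => ((i : ℕ) : ℤ) := fun a b hab =>
    Fin.ext (by simpa using hab)
  simp only [green, rescale_iter]
  rw [h (t * Y) _ ((pack (Fin d → R) m).symm (Function.update e 0 q'))
    (Finset.univ.image fun i : Fin m => ((i : ℕ) : ℤ)), Finset.sum_image hinj.injOn]
  · congr 1
    refine Finset.sum_congr rfl fun i _ => ?_
    rw [pack_symm_update, pack_symm_update]
    congr 2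
    ring
  · intro x hx
    have hx' : ∀ i : Fin m, ((i : ℕ) : ℤ) ≠ x := fun i hi =>
      hx (Finset.mem_image.2 ⟨i, Finset.mem_univ i, hi⟩)
    rw [pack_symm_update_of_notMem m e q hx', pack_symm_update_of_notMem m e q' hx']

/-- If `F` is concentrated at the point corresponding to the block coordinates `(X, Y)`, while the
kernel of `G` vanishes near the corresponding point, then the rescaling of `G` is not a
sub-automaton of that of `F`. -/
theorem HasKernel.not_isSubautomaton_rescale {d' : ℕ} [Nontrivial (Fin d' → R)]
    {F : CellularAutomaton (Fin d → R)} {G : CellularAutomaton (Fin d' → R)}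
    {K : ℕ → ℤ → Matrix (Fin d) (Fin d) R} {K' : ℕ → ℤ → Matrix (Fin d') (Fin d') R}
    (hF : F.HasKernel K) (hG : G.HasKernel K') {m₁ t₁ m₂ t₂ : ℕ+} {z₁ z₂ X : ℤ} {Y : ℕ}
    (h1 : K (t₂ * Y) (m₂ * X - z₂ * Y) = 1)
    (h2 : ∀ k : ℤ, k ≠ 0 → |k| ≤ (m₂ : ℕ) → K (t₂ * Y) (m₂ * X - z₂ * Y + k) = 0)
    (h3 : ∀ k : ℤ, |k| ≤ (m₁ : ℕ) → K' (t₁ * Y) (m₁ * X - z₁ * Y + k) = 0) :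
    ¬ (G.rescale m₁ t₁ z₁).IsSubautomaton (F.rescale m₂ t₂ z₂) := by
  rintro ⟨φ, hφ, hcomm⟩
  have habs {m : ℕ+} (i j : Fin m) : |((j : ℕ) : ℤ) - (i : ℕ)| ≤ (m : ℕ) := by
    rw [abs_le]
    omega
  have : Nonempty (Fin m₁) := ⟨⟨0, m₁.pos⟩⟩
  obtain ⟨q, q', hne⟩ := exists_pair_ne (Fin m₁ → Fin d' → R)
  have hconst : (G.rescale m₁ t₁ z₁).green X Y 0 q = (G.rescale m₁ t₁ z₁).green X Y 0 q' := by
    funext j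
    rw [hG.rescale_green_eq m₁ t₁ z₁ X Y 0 q q' j, Finset.sum_eq_zero, add_zero]
    intro i _
    rw [h3 _ (habs i j), Matrix.zero_mulVec]
  refine hne (hφ ?_)
  funext j
  have hj := hF.rescale_green_eq m₂ t₂ z₂ X Y (φ ∘ 0) (φ q) (φ q') j
  -- Only the diagonal term survives in the block of F, and it is the identity; since the Green map
  -- of G does not distinguish `q` from `q'`, this gives `φ q j = φ q' j`.
  rw [green_comp hcomm, green_comp hcomm, hconst, left_eq_add, Finset.sum_eq_single j, sub_self,
    add_zero, h1, Matrix.one_mulVec, sub_eq_zero] at hj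
  · exact hj
  · intro i _ hi
    rw [h2 _ _ (habs i j), Matrix.zero_mulVec]
    intro h0
    exact hi (Fin.ext (by omega))
  · simp

end Kernel

end CellularAutomaton

open CellularAutomaton Topology

/-! ### The vacuum of Γ⁻¹ at large scale -/

/-- An open set of points around which the powers of `Γ⁻¹` have no nonzero coefficient at large
scale: the complement of the light cone, and the images of a triangle under powers of two. -/
def vacuum : Set (ℝ × ℝ) :=
  {P | P.1 < 0 ∨ 2 * P.2 < P.1 ∨ ∃ j : ℤ, (2 : ℝ) ^ j - P.1 < P.2 ∧
    2 * P.2 < 2 * (2 : ℝ) ^ j + P.1 ∧ 3 * P.1 < 2 * (2 : ℝ) ^ j}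

theorem isOpen_vacuum : IsOpen vacuum := by
  have h : vacuum = {P : ℝ × ℝ | P.1 < 0} ∪ ({P : ℝ × ℝ | 2 * P.2 < P.1} ∪
      ⋃ j : ℤ, {P : ℝ × ℝ | (2 : ℝ) ^ j - P.1 < P.2} ∩
        ({P : ℝ × ℝ | 2 * P.2 < 2 * (2 : ℝ) ^ j + P.1} ∩
          {P : ℝ × ℝ | 3 * P.1 < 2 * (2 : ℝ) ^ j})) := by
    ext P
    simp [vacuum]
  rw [h]
  refine (isOpen_lt (by fun_prop) (by fun_prop)).union
    ((isOpen_lt (by fun_prop) (by fun_prop)).union (isOpen_iUnion fun j => ?_))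
  exact (isOpen_lt (by fun_prop) (by fun_prop)).inter
    ((isOpen_lt (by fun_prop) (by fun_prop)).inter (isOpen_lt (by fun_prop) (by fun_prop)))

theorem eventually_lt_mul_two_pow {δ : ℝ} (hδ : 0 < δ) (K : ℝ) :
    ∀ᶠ n : ℕ in atTop, K < δ * 2 ^ n :=
  ((tendsto_pow_atTop_atTop_of_one_lt (one_lt_two (α := ℝ))).const_mul_atTop hδ).eventually_gt_atTop
    K

/-- The inequalities defining `vacuum` are strict, so after scaling by 2^n they absorb any bounded
error. This tolerance is needed for blocks and for rounded times. -/
theorem eventually_coeff_eq_zero {P : ℝ × ℝ} (hP : P ∈ vacuum) (K : ℝ) :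
    ∀ᶠ n : ℕ in atTop, ∀ (a : ℤ) (b : ℕ), |a - P.1 * 2 ^ n| ≤ K → |b - P.2 * 2 ^ n| ≤ K →
      ∀ i j, ((dMat ^ b) i j).coeff a = 0 := by
  rcases hP with h | h | ⟨j, h1, h2, h3⟩
  · filter_upwards [eventually_lt_mul_two_pow (neg_pos.2 h) K] with n hn a b ha hb
    refine (dMat_pow_suppIn b).coeff_eq_zero fun hmem => ?_
    have h0 : (0 : ℝ) ≤ a := by exact_mod_cast hmem.1
    rw [abs_le] at ha
    linarith
  · filter_upwards [eventually_lt_mul_two_pow (sub_pos.2 h) (3 * K)] with n hn a b ha hb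
    refine (dMat_pow_suppIn b).coeff_eq_zero fun hmem => ?_
    have h0 : (a : ℝ) ≤ 2 * b := by exact_mod_cast hmem.2
    rw [abs_le] at ha hb
    linarith
  · filter_upwards [eventually_lt_mul_two_pow (sub_pos.2 h1) (2 * K),
      eventually_lt_mul_two_pow (sub_pos.2 h2) (3 * K),
      eventually_lt_mul_two_pow (sub_pos.2 h3) (3 * K + 3), eventually_ge_atTop (-j).toNat]
      with n hn1 hn2 hn3 hnj a b ha hb
    -- Once n ≥ -j, the scaled triangle is the integral one of size 2^N with N = j + n.
    obtain ⟨N, hN⟩ := Int.eq_ofNat_of_zero_le (show 0 ≤ j + n by omega)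
    have hpow : (2 : ℝ) ^ j * 2 ^ n = 2 ^ N := by
      rw [← zpow_natCast, ← zpow_natCast, ← hN, zpow_add₀ two_ne_zero]
    rw [abs_le] at ha hb
    have e1 : (2 : ℝ) ^ N - a < b := by rw [← hpow]; linarith
    have e2 : (2 * b : ℝ) < 2 * 2 ^ N + a := by rw [← hpow]; linarith
    have e3 : 3 * (a : ℝ) + 3 ≤ 2 * 2 ^ N := by rw [← hpow]; linarith
    exact coeff_dMat_pow_eq_zero (n := N) (by exact_mod_cast e1) (by exact_mod_cast e2)
      (by exact_mod_cast e3)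

/-! ### Density of good points on the half-lines and the segment -/

/-- Rational points, with first numerator divisible by `m`, around which all rescalings of the
powers of `Γ` are a shift. -/
def goodPoints (m : ℕ) : Set (ℝ × ℝ) :=
  {P | ∃ j p r : ℕ, P = ((m * p : ℝ) / 2 ^ j, (r : ℝ) / 2 ^ j) ∧ ∀ (n : ℕ) (w : ℤ), 0 < w →
    4 * w = 2 ^ n → AgreesNear (m * p * 2 ^ n) w (gMat ^ (r * 2 ^ n))}

/-- The two half-lines and the segment of the closure of `X_2(Γ)`. -/
def raysAndSegment : Set (ℝ × ℝ) :=
  {P | (P.1 = 0 ∧ 0 ≤ P.2) ∨ (P.1 = P.2 ∧ 0 ≤ P.2) ∨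
    (0 ≤ P.1 ∧ P.1 ≤ 2 / 3 ∧ P.2 = 1 - P.1 / 2)}

theorem tendsto_floor_div_two_pow {a : ℝ} (ha : 0 ≤ a) :
    Tendsto (fun j : ℕ => (⌊a * 2 ^ j⌋₊ : ℝ) / 2 ^ j) atTop (𝓝 a) :=
  (tendsto_nat_floor_mul_div_atTop ha).comp
    (tendsto_pow_atTop_atTop_of_one_lt (one_lt_two (α := ℝ)))

theorem tendsto_const_div_two_pow (a : ℝ) :
    Tendsto (fun j : ℕ => a / (2 : ℝ) ^ j) atTop (𝓝 0) :=
  tendsto_const_nhds.div_atTop (tendsto_pow_atTop_atTop_of_one_lt (one_lt_two (α := ℝ)))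

theorem axis_mem_closure_goodPoints (m : ℕ) {s : ℝ} (hs : 0 ≤ s) :
    ((0 : ℝ), s) ∈ closure (goodPoints m) := by
  refine mem_closure_of_tendsto (tendsto_const_nhds.prodMk_nhds (tendsto_floor_div_two_pow hs))
    (Eventually.of_forall fun j => ⟨j, 0, ⌊s * 2 ^ j⌋₊, by simp, fun n w hw hn => ?_⟩)
  simpa using gMat_agreesNear_axis ⌊s * 2 ^ j⌋₊ n hw hn

theorem diagonal_mem_closure_goodPoints {m : ℕ} (hm : 0 < m) {s : ℝ} (hs : 0 ≤ s) :
    (s, s) ∈ closure (goodPoints m) := by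
  have hm' : (0 : ℝ) < m := by exact_mod_cast hm
  have h1 := (tendsto_floor_div_two_pow (a := s / (4 * m)) (by positivity)).const_mul (4 * m : ℝ)
  rw [mul_div_cancel₀ s (by positivity : (4 * m : ℝ) ≠ 0)] at h1
  have h2 := h1.add (tendsto_const_div_two_pow 1)
  rw [add_zero] at h2
  refine mem_closure_of_tendsto (h1.prodMk_nhds h2) (Eventually.of_forall fun j => ?_)
  generalize ⌊s / (4 * m) * 2 ^ j⌋₊ = q
  refine ⟨j, 4 * q, 4 * (m * q) + 1, ?_, fun n w hw hn => ?_⟩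
  · push_cast
    ext <;> simp <;> ring
  · have := gMat_agreesNear_diagonal (m * q) n hw hn
    push_cast at this ⊢
    rwa [show (m * (4 * q) : ℤ) = 4 * (m * q) by ring]

theorem segment_mem_closure_goodPoints {m : ℕ} (hm : 0 < m) {s : ℝ} (hs : 0 ≤ s)
    (hs' : s < 2 / 3) : (s, 1 - s / 2) ∈ closure (goodPoints m) := by
  have hm' : (0 : ℝ) < m := by exact_mod_cast hm
  have h0 := tendsto_floor_div_two_pow (a := s / (4 * m)) (by positivity)
  have h1 := h0.const_mul (4 * m : ℝ)
  have h2 := ((h0.const_mul (2 * m : ℝ)).add (tendsto_const_div_two_pow 1)).const_sub 1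
  have h3 := (h0.const_mul (12 * m : ℝ)).add (tendsto_const_div_two_pow 12)
  have e1 : 4 * m * (s / (4 * m)) = s := by field_simp
  have e2 : 1 - (2 * m * (s / (4 * m)) + 0) = 1 - s / 2 := by field_simp; ring
  have e3 : 12 * m * (s / (4 * m)) + 0 = 3 * s := by field_simp; ring
  rw [e1] at h1
  rw [e2] at h2
  rw [e3] at h3
  refine mem_closure_of_tendsto (h1.prodMk_nhds h2) ?_
  filter_upwards [h3.eventually_lt_const (show 3 * s < 2 by linarith)] with j hj
  generalize ⌊s / (4 * m) * 2 ^ j⌋₊ = q at *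
  have hpow : (0 : ℝ) < 2 ^ j := by positivity
  have hq : 12 * (m * q) + 12 ≤ 2 * 2 ^ j := by
    rw [← mul_div_assoc, ← add_div, div_lt_iff₀ hpow] at hj
    have : (12 * (m * q) + 12 : ℝ) ≤ 2 * 2 ^ j := by linarith
    exact_mod_cast this
  refine ⟨j, 4 * q, 2 ^ j - (2 * (m * q) + 1), ?_, fun n w hw hn => ?_⟩
  · rw [Nat.cast_sub (by omega)]
    push_cast
    ext <;> simp <;> field_simp
  · have := gMat_agreesNear_segment (m * q) j n hw hn hq
    push_cast at this ⊢
    rwa [show (m * (4 * q) : ℤ) = 4 * (m * q) by ring]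

theorem raysAndSegment_subset_closure {m : ℕ} (hm : 0 < m) :
    raysAndSegment ⊆ closure (goodPoints m) := by
  rintro ⟨x, y⟩ (⟨hx, hy⟩ | ⟨hx, hy⟩ | ⟨hx, hx', hy⟩)
  · obtain rfl : x = 0 := hx
    exact axis_mem_closure_goodPoints m hy
  · obtain rfl : x = y := hx
    exact diagonal_mem_closure_goodPoints hm hy
  · obtain rfl : y = 1 - x / 2 := hy
    have hcl : IsClosed {s : ℝ | (s, 1 - s / 2) ∈ closure (goodPoints m)} :=
      isClosed_closure.preimage (by fun_prop : Continuous fun s : ℝ => (s, 1 - s / 2))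
    have hsub : Set.Ico (0 : ℝ) (2 / 3) ⊆ {s : ℝ | (s, 1 - s / 2) ∈ closure (goodPoints m)} :=
      fun s hs => segment_mem_closure_goodPoints hm hs.1 hs.2
    have := closure_minimal hsub hcl
    rw [closure_Ico (by norm_num)] at this
    exact this ⟨hx, hx'⟩

/-! ### Plane maps cannot avoid the vacuum -/

theorem exists_mem_vacuum_of_ray {x y : ℝ} (hx : 0 < x) (hxy : x < 2 * y) :
    ∃ s : ℝ, 0 ≤ s ∧ (s * x, s * y) ∈ vacuum := by
  -- Scaling by 1/σ puts the point in the triangle of size 1 exactly when σ lies in this interval,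
  -- which is nonempty because x < 2y.
  obtain ⟨σ, h1, h2⟩ := exists_between
    (max_lt (by linarith : y - x / 2 < x + y) (by linarith : 3 * x / 2 < x + y))
  rw [max_lt_iff] at h1
  have hσ : 0 < σ := by linarith
  have hs : 0 < σ⁻¹ := inv_pos.2 hσ
  have e : σ⁻¹ * σ = 1 := inv_mul_cancel₀ hσ.ne'
  have k1 := mul_lt_mul_of_pos_left h1.1 hs
  have k2 := mul_lt_mul_of_pos_left h1.2 hs
  have k3 := mul_lt_mul_of_pos_left h2 hs
  refine ⟨σ⁻¹, hs.le, Or.inr (Or.inr ⟨0, ?_, ?_, ?_⟩)⟩ <;> rw [zpow_zero] <;> linarith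

theorem eq_zero_or_of_ray_notMem {x y : ℝ} (h : ∀ s : ℝ, 0 ≤ s → (s * x, s * y) ∉ vacuum) :
    x = 0 ∨ x = 2 * y := by
  rcases lt_trichotomy x 0 with hx | hx | hx
  · exact absurd (Or.inl (by simpa using hx)) (h 1 zero_le_one)
  · exact Or.inl hx
  rcases lt_trichotomy x (2 * y) with hy | hy | hy
  · obtain ⟨s, hs, hmem⟩ := exists_mem_vacuum_of_ray hx hy
    exact absurd hmem (h s hs)
  · exact Or.inr hy
  · exact absurd (Or.inr (Or.inl (by simpa using hy))) (h 1 zero_le_one)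

theorem exists_planeMap_mem_vacuum {α β γ : ℝ} (hα : 0 < α) (hγ : 0 < γ) :
    ∃ P ∈ raysAndSegment, (α * P.1 + β * P.2, γ * P.2) ∈ vacuum := by
  by_contra! h
  have h1 : β = 0 ∨ β = 2 * γ := eq_zero_or_of_ray_notMem fun s hs => by
    have := h (0, s) (Or.inl ⟨rfl, hs⟩)
    simpa [mul_comm] using this
  have h2 : α + β = 0 ∨ α + β = 2 * γ := eq_zero_or_of_ray_notMem fun s hs => by
    have := h (s, s) (Or.inr (Or.inl ⟨rfl, hs⟩))
    simpa [mul_comm, mul_add] using this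
  -- Since α > 0, the order of the two half-lines is preserved: they go to the left and right edges
  -- of the cone respectively.
  obtain rfl : β = 0 := by
    rcases h1 with h1 | h1 <;> rcases h2 with h2 | h2 <;> linarith
  obtain rfl : α = 2 * γ := by
    rcases h2 with h2 | h2 <;> linarith
  have h3 : ∀ s : ℝ, 0 ≤ s → s ≤ 2 / 3 → (2 * γ * s, γ * (1 - s / 2)) ∉ vacuum :=
    fun s hs hs' => by
      simpa using h (s, 1 - s / 2) (Or.inr (Or.inr ⟨hs, hs', rfl⟩))
  obtain ⟨j, hj1, hj2⟩ := exists_mem_Ico_zpow hγ (one_lt_two (α := ℝ))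
  rcases hj1.eq_or_lt with hj | hj
  · refine h3 (1 / 10) (by norm_num) (by norm_num) (Or.inr (Or.inr ⟨j, ?_, ?_, ?_⟩)) <;>
      rw [hj] <;> linarith
  · rw [zpow_add₀ two_ne_zero, zpow_one] at hj2
    set ρ := (2 : ℝ) ^ j * 2 / γ with hρ
    have e : (2 : ℝ) ^ j * 2 = ρ * γ := by rw [hρ, div_mul_cancel₀ _ hγ.ne']
    have r1 : 1 < ρ := by rwa [hρ, one_lt_div hγ]
    have r2 : ρ < 2 := by rw [hρ, div_lt_iff₀ hγ]; linarith
    -- The triangle of size ργ requires 2(ρ - 1)/3 < s < ρ/3, an interval that is nonempty for ρ <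
    -- 2; the witness is its midpoint.
    refine h3 (ρ / 2 - 1 / 3) (by linarith) (by linarith)
      (Or.inr (Or.inr ⟨j + 1, ?_, ?_, ?_⟩)) <;>
      rw [zpow_add₀ two_ne_zero, zpow_one, e] <;> nlinarith

theorem exists_mirror_planeMap_mem_vacuum {α β γ : ℝ} (hα : 0 < α) (hγ : 0 < γ) :
    ∃ P ∈ raysAndSegment, (-(α * P.1 + β * P.2), γ * P.2) ∈ vacuum := by
  by_contra! h
  have h1 : -β = 0 ∨ -β = 2 * γ := eq_zero_or_of_ray_notMem fun s hs => by
    have := h (0, s) (Or.inl ⟨rfl, hs⟩)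
    simpa [mul_comm] using this
  have h2 : -(α + β) = 0 ∨ -(α + β) = 2 * γ := eq_zero_or_of_ray_notMem fun s hs => by
    have := h (s, s) (Or.inr (Or.inl ⟨rfl, hs⟩))
    rwa [mul_comm s γ, show s * -(α + β) = -(α * s + β * s) by ring]
  -- The reflection exchanges the roles: x = 0 goes to the right edge and the diagonal to the left
  -- one. The endpoint (2/3, 2/3) then lands on the left edge, hence the parameter `e` measured from
  -- it.
  obtain rfl : β = -(2 * γ) := by
    rcases h1 with h1 | h1 <;> rcases h2 with h2 | h2 <;> linarith
  obtain rfl : α = 2 * γ := by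
    rcases h2 with h2 | h2 <;> linarith
  have h3 : ∀ e : ℝ, 0 ≤ e → e ≤ 2 / 3 → (3 * γ * e, γ * (2 / 3 + e / 2)) ∉ vacuum :=
    fun e he he' => by
      have := h (2 / 3 - e, 1 - (2 / 3 - e) / 2)
        (Or.inr (Or.inr ⟨by simpa using he', by simpa using he, rfl⟩))
      convert this using 3 <;> ring
  obtain ⟨j, hj1, hj2⟩ := exists_mem_Ico_zpow (show 0 < 2 / 3 * γ by positivity)
    (one_lt_two (α := ℝ))
  rcases hj1.eq_or_lt with hj | hj
  · refine h3 (1 / 10) (by norm_num) (by norm_num) (Or.inr (Or.inr ⟨j, ?_, ?_, ?_⟩)) <;>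
      rw [hj] <;> linarith
  · rw [zpow_add₀ two_ne_zero, zpow_one] at hj2
    have hγ' : 0 < 2 / 3 * γ := by positivity
    set ρ := (2 : ℝ) ^ j * 2 / (2 / 3 * γ) with hρ
    have e : (2 : ℝ) ^ j * 2 = ρ * (2 / 3 * γ) := by rw [hρ, div_mul_cancel₀ _ hγ'.ne']
    have r1 : 1 < ρ := by rwa [hρ, one_lt_div hγ']
    have r2 : ρ < 2 := by rw [hρ, div_lt_iff₀ hγ']; linarith
    -- The admissible range is 4(ρ - 1)/21 < e < 4ρ/27, which contains ρ/7 whenever 1 < ρ < 2.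
    refine h3 (ρ / 7) (by linarith) (by linarith)
      (Or.inr (Or.inr ⟨j + 1, ?_, ?_, ?_⟩)) <;>
      rw [zpow_add₀ two_ne_zero, zpow_one, e] <;> nlinarith

/-! ### Fingerprints and the obstruction to simulation -/

theorem hasKernel_gamma :
    gammaCA.ca.HasKernel fun y k => Matrix.of fun i j => ((gMat ^ y) i j).coeff k :=
  hasKernel_linear gMat

/-- The factor 1 here, and -1 for the dual, is the sign ε that lets one argument handle both
automata. -/
theorem hasKernel_gamma_inv :
    gammaCA.inv.HasKernel fun y k => Matrix.of fun i j => ((dMat ^ y) i j).coeff (1 * k) := by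
  simp only [one_mul]
  exact hasKernel_linear dMat

theorem hasKernel_gamma_dual :
    gammaCA.dual.HasKernel fun y k => Matrix.of fun i j => ((dMat ^ y) i j).coeff (-1 * k) := by
  simp only [neg_one_mul]
  exact (hasKernel_linear dMat).mirror

theorem goodPoints_subset_fingerprint (m : ℕ) : goodPoints m ⊆ gammaCA.ca.fingerprint 2 := by
  rintro _ ⟨j, p, r, rfl, h⟩
  refine ⟨by positivity, j + 2, ?_⟩
  filter_upwards [eventually_ge_atTop (j + 2)] with n hn
  obtain ⟨N, rfl⟩ := Nat.exists_eq_add_of_le hn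
  have hA := h (N + 2) (2 ^ N) (by positivity) (by rw [pow_add]; ring)
  have e : (2 : ℝ) ^ (j + 2 + N) = 2 ^ j * 2 ^ (N + 2) := by rw [← pow_add]; congr 1; omega
  refine ⟨hn, m * p * 2 ^ (N + 2), r * 2 ^ (N + 2), ?_, ?_, ?_⟩
  · push_cast
    rw [e]
    field_simp
  · push_cast
    rw [e]
    field_simp
  · rw [Nat.add_sub_cancel_left]
    refine hasKernel_gamma.concentrated ?_ fun z hz hne => ?_
    · ext a b
      rw [Matrix.of_apply, hA.coeff_eq (by simp) (by simp), if_pos rfl]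
    · obtain ⟨hz1, hz2⟩ := hz
      push_cast at hz1 hz2
      ext a b
      rw [Matrix.of_apply, hA.coeff_eq hz1 hz2, if_neg hne.symm, Matrix.zero_apply]

theorem raysAndSegment_subset_closure_fingerprint :
    raysAndSegment ⊆ closure (gammaCA.ca.fingerprint 2) :=
  (raysAndSegment_subset_closure one_pos).trans
    (closure_mono (goodPoints_subset_fingerprint 1))

section Obstruction

variable {G : CellularAutomaton (Fin 3 → ZMod 2)} {ε : ℤ}

theorem notMem_vacuum_of_mem_fingerprint
    (hG : G.HasKernel fun y k => Matrix.of fun i j => ((dMat ^ y) i j).coeff (ε * k))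
    {P : ℝ × ℝ} (hP : P ∈ G.fingerprint 2) : ((ε : ℝ) * P.1, P.2) ∉ vacuum := by
  intro hv
  obtain ⟨-, k, hk⟩ := hP
  obtain ⟨n, ⟨-, a, b, ha, hb, hc⟩, hn⟩ := (hk.and (eventually_coeff_eq_zero hv 0)).exists
  refine hG.not_concentrated ?_ hc
  ext i j
  refine hn (ε * a) b ?_ ?_ i j
  · push_cast at ha ⊢
    rw [ha, mul_assoc, sub_self, abs_zero]
  · push_cast at hb ⊢
    rw [hb, sub_self, abs_zero]

theorem notMem_vacuum_of_mem_closure_fingerprint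
    (hG : G.HasKernel fun y k => Matrix.of fun i j => ((dMat ^ y) i j).coeff (ε * k))
    {P : ℝ × ℝ} (hP : P ∈ closure (G.fingerprint 2)) : ((ε : ℝ) * P.1, P.2) ∉ vacuum := by
  have hcl : IsClosed {P : ℝ × ℝ | ((ε : ℝ) * P.1, P.2) ∉ vacuum} :=
    isOpen_vacuum.isClosed_compl.preimage
      (by fun_prop : Continuous fun P : ℝ × ℝ => ((ε : ℝ) * P.1, P.2))
  exact closure_minimal (fun _ hQ => notMem_vacuum_of_mem_fingerprint hG hQ) hcl hP

theorem not_mapsTo_closure_fingerprint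
    (hG : G.HasKernel fun y k => Matrix.of fun i j => ((dMat ^ y) i j).coeff (ε * k))
    {α β γ : ℝ}
    (h : ∃ P ∈ raysAndSegment, ((ε : ℝ) * (α * P.1 + β * P.2), γ * P.2) ∈ vacuum) :
    ¬ Set.MapsTo (planeMap α β γ) (closure (gammaCA.ca.fingerprint 2))
      (closure (G.fingerprint 2)) := by
  intro hmaps
  obtain ⟨P, hP, hv⟩ := h
  exact notMem_vacuum_of_mem_closure_fingerprint hG
    (hmaps (raysAndSegment_subset_closure_fingerprint hP)) hv

/-- Close to a good point there are integral points divisible by `m` where the powers of `Γ` are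
locally a shift. -/
theorem eventually_exists_dvd_agreesNear {m : ℕ} (hm : 0 < m) {P : ℝ × ℝ} (hP : P ∈ goodPoints m)
    (l : ℕ) : ∃ K : ℝ, ∀ᶠ n : ℕ in atTop, ∃ (p : ℤ) (r : ℕ), ((m * p : ℤ) : ℝ) = P.1 * 2 ^ n ∧
      |((m * r : ℕ) : ℝ) - P.2 * 2 ^ n| ≤ K ∧ AgreesNear (m * p) l (gMat ^ (m * r)) := by
  obtain ⟨j, p, r, rfl, h⟩ := hP
  refine ⟨m * 2 ^ (l + 2), ?_⟩
  filter_upwards [eventually_ge_atTop (j + 2 + (l + (l + 2) + m))] with n hn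
  obtain ⟨N, rfl⟩ := Nat.exists_eq_add_of_le hn
  set M := l + (l + 2) + m + N with hM
  have hn' : j + 2 + (l + (l + 2) + m) + N = j + (M + 2) := by omega
  have hMl : M + 2 = (l + 2) + (l + m + N + 2) := by omega
  set s := r * 2 ^ (l + m + N + 2) with hs
  have hrs : r * 2 ^ (M + 2) = s * 2 ^ (l + 2) := by
    rw [hMl, hs, pow_add, mul_assoc, mul_comm (2 ^ (l + 2))]
  -- The time is rounded up to a multiple of m · 2^(l+2). The extra factor of G is a power of
  -- exponent divisible by 2^(l+2), hence 1 up to exponents beyond `l`, and the shift pattern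
  -- survives on a window of half-width `l`.
  have hdvd : m * ((s / m + 1) * 2 ^ (l + 2)) =
      r * 2 ^ (M + 2) + (m - s % m) * 2 ^ (l + 2) := by
    rw [hrs, ← add_mul, ← mul_assoc]
    congr 1
    have h1 := Nat.div_add_mod s m
    have h2 := Nat.mod_lt s hm
    rw [mul_add, mul_one]
    omega
  have e : (2 : ℝ) ^ (j + (M + 2)) = 2 ^ j * 2 ^ (M + 2) := pow_add _ _ _
  have hr' : (m - s % m) * 2 ^ (l + 2) ≤ m * 2 ^ (l + 2) :=
    Nat.mul_le_mul_right _ (Nat.sub_le _ _)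
  refine ⟨p * 2 ^ (M + 2), (s / m + 1) * 2 ^ (l + 2), ?_, ?_, ?_⟩
  · rw [hn', e]
    push_cast
    field_simp
  · rw [hdvd, hn', e, Nat.cast_add]
    clear_value M s
    have : ((r * 2 ^ (M + 2) : ℕ) : ℝ) - (r : ℝ) / 2 ^ j * (2 ^ j * 2 ^ (M + 2)) = 0 := by
      push_cast
      field_simp
      ring
    rw [add_sub_right_comm, this, zero_add, Nat.abs_cast]
    exact_mod_cast hr'
  · rw [hdvd, pow_add gMat]
    obtain ⟨c, hc, hB⟩ := gMat_suppIn_multiple (m - s % m) (l + 2)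
    have hA := h (M + 2) (2 ^ M) (by positivity) (by rw [pow_add]; ring)
    have hl : (l : ℤ) < 2 ^ l := by exact_mod_cast Nat.lt_two_pow_self
    rw [← mul_assoc (m : ℤ)]
    refine hA.mul (gMat_pow_suppIn _) hB ?_ ?_
    · have h1 : l + m * 2 ^ (l + 2) ≤ 2 ^ M := by
        have hm2 : m + 1 ≤ 2 ^ m := Nat.lt_two_pow_self
        have hl2 : l ≤ 2 ^ (l + 2) :=
          (Nat.lt_two_pow_self (n := l)).le.trans (Nat.pow_le_pow_right two_pos (by omega))
        calc l + m * 2 ^ (l + 2) ≤ (m + 1) * 2 ^ (l + 2) := by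
              rw [Nat.succ_mul]
              omega
          _ ≤ 2 ^ m * 2 ^ (l + 2) := Nat.mul_le_mul_right _ hm2
          _ = 2 ^ (m + (l + 2)) := (pow_add _ _ _).symm
          _ ≤ 2 ^ M := Nat.pow_le_pow_right two_pos (by omega)
      have h2 : ((l + (m - s % m) * 2 ^ (l + 2) : ℕ) : ℤ) ≤ ((2 ^ M : ℕ) : ℤ) :=
        Int.ofNat_le.2 ((Nat.add_le_add_left hr' l).trans h1)
      simpa only [Nat.cast_add, Nat.cast_pow, Nat.cast_ofNat] using h2
    · rw [pow_add] at hc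
      omega

theorem not_simulates (hε : |(ε : ℝ)| = 1)
    (hG : G.HasKernel fun y k => Matrix.of fun i j => ((dMat ^ y) i j).coeff (ε * k))
    (h : ∀ α β γ : ℝ, 0 < α → 0 < γ →
      ∃ P ∈ raysAndSegment, ((ε : ℝ) * (α * P.1 + β * P.2), γ * P.2) ∈ vacuum) :
    ¬ gammaCA.ca.Simulates G := by
  rintro ⟨m₁, t₁, m₂, t₂, z₁, z₂, hsub⟩
  have hm₁ : (0 : ℝ) < (m₁ : ℕ) := by exact_mod_cast m₁.pos
  have ht₁ : (0 : ℝ) < (t₁ : ℕ) := by exact_mod_cast t₁.pos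
  have hm₂ : (0 : ℝ) < (m₂ : ℕ) := by exact_mod_cast m₂.pos
  have ht₂ : (0 : ℝ) < (t₂ : ℕ) := by exact_mod_cast t₂.pos
  obtain ⟨α, hα⟩ : ∃ α : ℝ, α = (m₁ : ℕ) / (m₂ : ℕ) := ⟨_, rfl⟩
  obtain ⟨γ, hγ⟩ : ∃ γ : ℝ, γ = (t₁ : ℕ) / (t₂ : ℕ) := ⟨_, rfl⟩
  -- Eliminating (X, Y) between (m₂X - z₂Y, t₂Y) and (m₁X - z₁Y, t₁Y) gives the plane map with these
  -- coefficients.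
  obtain ⟨β, hβ⟩ : ∃ β : ℝ, β = ((m₁ : ℕ) * z₂ / (m₂ : ℕ) - z₁) / (t₂ : ℕ) := ⟨_, rfl⟩
  have hα0 : 0 < α := hα ▸ div_pos hm₁ hm₂
  have hγ0 : 0 < γ := hγ ▸ div_pos ht₁ ht₂
  obtain ⟨P₀, hP₀, hv₀⟩ := h α β γ hα0 hγ0
  have hm : 0 < (m₂ : ℕ) * t₂ := Nat.mul_pos m₂.pos t₂.pos
  have hopen : IsOpen {P : ℝ × ℝ | ((ε : ℝ) * (α * P.1 + β * P.2), γ * P.2) ∈ vacuum} :=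
    isOpen_vacuum.preimage
      (by fun_prop : Continuous fun P : ℝ × ℝ => ((ε : ℝ) * (α * P.1 + β * P.2), γ * P.2))
  obtain ⟨P, hv, hP⟩ := mem_closure_iff.1 (raysAndSegment_subset_closure hm hP₀) _ hopen hv₀
  obtain ⟨K, hK⟩ := eventually_exists_dvd_agreesNear hm hP m₂
  obtain ⟨n, ⟨p, r, hp, hr, hA⟩, hn⟩ :=
    (hK.and (eventually_coeff_eq_zero hv (|β| * K + (m₁ : ℕ) + γ * K))).exists
  have hK0 : 0 ≤ K := (abs_nonneg _).trans hr
  have hpow : (t₂ : ℕ) * (m₂ * r) = m₂ * t₂ * r := by ring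
  have hpos : ((m₂ : ℕ) : ℤ) * (t₂ * p + z₂ * r) - z₂ * ((m₂ * r : ℕ) : ℤ) =
      ((m₂ * t₂ : ℕ) : ℤ) * p := by
    push_cast
    ring
  -- These integral block coordinates correspond to the point (m₂t₂p, m₂t₂r) for Γ; divisibility by
  -- m₂t₂ was imposed for this purpose.
  refine hasKernel_gamma.not_isSubautomaton_rescale hG (X := t₂ * p + z₂ * r) (Y := m₂ * r)
    ?_ ?_ ?_ hsub
  · ext a b
    rw [Matrix.of_apply, hpow, hpos, hA.coeff_eq (by simp) (by simp), if_pos rfl]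
  · intro k hk0 hk
    rw [abs_le] at hk
    ext a b
    rw [Matrix.of_apply, hpow, hpos, hA.coeff_eq (by linarith) (by linarith), if_neg (by omega),
      Matrix.zero_apply]
  · intro k hk
    ext a b
    refine hn _ _ ?_ ?_ a b
    · have hk' : |(k : ℝ)| ≤ (m₁ : ℕ) := by exact_mod_cast hk
      have e : ((ε * ((m₁ : ℕ) * (t₂ * p + z₂ * r) - z₁ * ((m₂ * r : ℕ) : ℤ) + k) : ℤ) : ℝ) -
          (ε : ℝ) * (α * P.1 + β * P.2) * 2 ^ n =
          ε * (β * (((m₂ * t₂ * r : ℕ) : ℝ) - P.2 * 2 ^ n) + k) := by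
        have : (ε : ℝ) * (α * P.1 + β * P.2) * 2 ^ n =
            ε * (α * (P.1 * 2 ^ n) + β * (P.2 * 2 ^ n)) := by ring
        rw [this, ← hp, hα, hβ]
        push_cast
        field_simp
        ring
      rw [e, abs_mul, hε, one_mul]
      refine (abs_add_le _ _).trans ?_
      rw [abs_mul]
      have := mul_le_mul_of_nonneg_left hr (abs_nonneg β)
      have := mul_nonneg hγ0.le hK0
      linarith
    · have e : ((t₁ * (m₂ * r) : ℕ) : ℝ) - γ * P.2 * 2 ^ n =
          γ * (((m₂ * t₂ * r : ℕ) : ℝ) - P.2 * 2 ^ n) := by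
        rw [hγ]
        push_cast
        field_simp
      rw [e, abs_mul, abs_of_pos hγ0]
      have := mul_le_mul_of_nonneg_left hr hγ0.le
      have := mul_nonneg (abs_nonneg β) hK0
      linarith

end Obstruction

theorem interior_triangle_subset_vacuum :
    interior (convexHull ℝ
      {((0 : ℝ), (1 : ℝ)), ((2 / 3 : ℝ), (1 / 3 : ℝ)), ((2 / 3 : ℝ), (4 / 3 : ℝ))}) ⊆ vacuum := by
  set s : Set (ℝ × ℝ) := convexHull ℝ
    {((0 : ℝ), (1 : ℝ)), ((2 / 3 : ℝ), (1 / 3 : ℝ)), ((2 / 3 : ℝ), (4 / 3 : ℝ))} with hs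
  have hsub : s ⊆ {P : ℝ × ℝ | 1 - P.1 ≤ P.2 ∧ 2 * P.2 ≤ 2 + P.1 ∧ 3 * P.1 ≤ 2} := by
    refine convexHull_min ?_ ?_
    · rintro P (rfl | rfl | rfl) <;> norm_num
    · rintro P ⟨h1, h2, h3⟩ Q ⟨k1, k2, k3⟩ a b ha hb hab
      simp only [Set.mem_ofPred_eq, Prod.fst_add, Prod.snd_add, Prod.smul_fst, Prod.smul_snd,
        smul_eq_mul]
      obtain rfl : b = 1 - a := by linarith
      refine ⟨?_, ?_, ?_⟩ <;> nlinarith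
  intro P hP
  have hnear (v : ℝ × ℝ) : ∃ t : ℝ, 0 < t ∧ P + t • v ∈ s := by
    have hc : Tendsto (fun t : ℝ => P + t • v) (𝓝[>] 0) (𝓝 P) := by
      have : Continuous fun t : ℝ => P + t • v := by fun_prop
      simpa using (this.tendsto 0).mono_left nhdsWithin_le_nhds
    obtain ⟨t, ht, ht0⟩ := ((hc.eventually (mem_interior_iff_mem_nhds.1 hP)).and
      self_mem_nhdsWithin).exists
    exact ⟨t, ht0, ht⟩
  -- Moving an interior point slightly towards each side turns the three weak inequalities into
  -- strict ones.
  obtain ⟨t1, p1, h1⟩ := hnear (-1, 0)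
  obtain ⟨t2, p2, h2⟩ := hnear (0, 1)
  obtain ⟨t3, p3, h3⟩ := hnear (1, 0)
  have k1 := (hsub h1).1
  have k2 := (hsub h2).2.1
  have k3 := (hsub h3).2.2
  simp at k1 k2 k3
  refine Or.inr (Or.inr ⟨0, ?_, ?_, ?_⟩) <;> rw [zpow_zero] <;> linarith

theorem segment_subset_raysAndSegment :
    segment ℝ ((0 : ℝ), (1 : ℝ)) ((2 / 3 : ℝ), (2 / 3 : ℝ)) ⊆ raysAndSegment := by
  rintro _ ⟨a, b, ha, hb, hab, rfl⟩
  obtain rfl : a = 1 - b := by linarith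
  refine Or.inr (Or.inr ⟨?_, ?_, ?_⟩) <;> simp <;> linarith

end

theorem mainTheorem4 :
    -- `Γ` simulates neither its inverse nor its dual
    ¬ gammaCA.ca.Simulates gammaCA.inv ∧
    ¬ gammaCA.ca.Simulates gammaCA.dual ∧
    -- the closure of `X_2(Γ)` contains the two half-lines and the segment
    (∀ s : ℝ, 0 ≤ s → ((0 : ℝ), s) ∈ closure (gammaCA.ca.fingerprint 2)) ∧
    (∀ s : ℝ, 0 ≤ s → (s, s) ∈ closure (gammaCA.ca.fingerprint 2)) ∧
    segment ℝ ((0 : ℝ), (1 : ℝ)) ((2 / 3 : ℝ), (2 / 3 : ℝ)) ⊆ closure (gammaCA.ca.fingerprint 2) ∧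
    -- `X_2(Γ⁻¹)` avoids the interior of the triangle
    Disjoint (gammaCA.inv.fingerprint 2)
      (interior (convexHull ℝ
        {((0 : ℝ), (1 : ℝ)), ((2 / 3 : ℝ), (1 / 3 : ℝ)), ((2 / 3 : ℝ), (4 / 3 : ℝ))})) ∧
    -- no map `π_{α,β,γ}` sends the closure of `X_2(Γ)` into that of `X_2` of the inverse or the dual
    ∀ α β γ : ℝ, 0 < α → 0 < γ →
      ¬ Set.MapsTo (planeMap α β γ) (closure (gammaCA.ca.fingerprint 2))
          (closure (gammaCA.inv.fingerprint 2)) ∧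
      ¬ Set.MapsTo (planeMap α β γ) (closure (gammaCA.ca.fingerprint 2))
          (closure (gammaCA.dual.fingerprint 2)) := by
  have hplane : ∀ α β γ : ℝ, 0 < α → 0 < γ →
      ∃ P ∈ raysAndSegment, (((1 : ℤ) : ℝ) * (α * P.1 + β * P.2), γ * P.2) ∈ vacuum :=
    fun α β γ hα hγ => by
      simpa only [Int.cast_one, one_mul] using exists_planeMap_mem_vacuum hα hγ
  have hmirror : ∀ α β γ : ℝ, 0 < α → 0 < γ →
      ∃ P ∈ raysAndSegment, (((-1 : ℤ) : ℝ) * (α * P.1 + β * P.2), γ * P.2) ∈ vacuum :=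
    fun α β γ hα hγ => by
      simpa only [Int.cast_neg, Int.cast_one, neg_one_mul] using
        exists_mirror_planeMap_mem_vacuum hα hγ
  have hcl := raysAndSegment_subset_closure_fingerprint
  refine ⟨not_simulates (by simp) hasKernel_gamma_inv hplane,
    not_simulates (by simp) hasKernel_gamma_dual hmirror,
    fun s hs => hcl (Or.inl ⟨rfl, hs⟩), fun s hs => hcl (Or.inr (Or.inl ⟨rfl, hs⟩)),
    segment_subset_raysAndSegment.trans hcl, ?_, fun α β γ hα hγ =>
      ⟨not_mapsTo_closure_fingerprint hasKernel_gamma_inv (hplane α β γ hα hγ),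
        not_mapsTo_closure_fingerprint hasKernel_gamma_dual (hmirror α β γ hα hγ)⟩⟩
  refine Set.disjoint_left.2 fun P hP hint => ?_
  have := notMem_vacuum_of_mem_fingerprint hasKernel_gamma_inv hP
  rw [Int.cast_one, one_mul] at this
  exact this (interior_triangle_subset_vacuum hint)
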